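/- Let $p$ be a prime, and let $v_p$ be the $p$-adic valuation on $\mathbf{C}_p$ with $v_p(p)=1$, $v_p(0)=+\infty$. Let $C(t)=\{x\in\mathbf{C}_p : v_p(x)=t\}$. For a nonzero power series $F=\sum_{i\ge 0}F_iX^i\in\mathbf{C}_p[[X]]$, the characteristic sequence $k_0<k_1<\cdots$ (finite or infinite) is defined as follows: $k_0$ is the least index with $F_{k_0}\neq 0$ (so $k_0=0$ if $F(0)\ne0$), and $k_n$ is the largest integer $i>k_{n-1}$ at which $\dfrac{v_p(F_{k_{n-1}})-v_p(F_i)}{i-k_{n-1}}$ attains its maximum over all integers $i>k_{n-1}$; the sequence stops at $k_{n-1}$ if there is no such largest integer. For $n\ge 1$ put $\alpha_n=\dfrac{v_p(F_{k_{n-1}})-v_p(F_{k_n})}{k_n-k_{n-1}}$. Let $G=\sum_{i\ge 0} G_iX^i\in\mathbf{C}_p[[X]]$ be another nonzero power series, with characteristic sequence $(l_m)$ and corresponding valuations $(\beta_m)$. Let $\mathscr{C}(F,t)=\prod_{F(z)=0,\ v_p(z)=t}(X-z)$, zeros being repeated according to multiplicity, and let $\phi(x)=\min(v_p(F(x)),v_p(G(x)))$.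 Theorem. Let $n,m\ge 1$ be such that $k_n$ and $l_m$ exist and $\alpha_n=\beta_m$, and suppose that $F$ and $G$ converge on the circle $C(\alpha_n)$. Put $$a=\min\{v_p(F_{k_n})+k_{n-1}\alpha_n,\ v_p(G_{l_m})+l_{m-1}\alpha_n\},\qquad b=\max\{v_p(F_{k_n})+k_{n-1}\alpha_n,\ v_p(G_{l_m})+l_{m-1}\alpha_n\},$$ and $r=\mathrm{Res}(\mathscr{C}(F,\alpha_n),\mathscr{C}(G,\beta_m))$. Then $\phi$ attains a maximum on $C(\alpha_n)$ (in $\mathbf{R}\cup\{+\infty\}$), and $$a+\frac{v_p(r)}{\min\{l_m-l_{m-1},\,k_n-k_{n-1}\}}\ \le\ \max_{x\in C(\alpha_n)}\phi(x).$$ If moreover $\alpha_n\ge 0$, i.e. the circle lies in the closed unit disc, then $$\max_{x\in C(\alpha_n)}\phi(x)\ \le\ b+v_p(r).$$ If in addition $F,G\in K[[X]]$, where $K\subset\mathbf{C}_p$ is a finite extension of $\mathbf{Q}_p$ with uniformizer $\pi$, and $v_\pi$ is the valuation of $K$ with $v_\pi(\pi)=1$, then $$\max_{x\in C(\alpha_n)}\phi(x)\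 \le\ b+c\,v_p(r),$$ $$c=\max\left\{\frac{\gcd(v_\pi(F_{k_n})-v_\pi(F_{k_{n-1}}),\,k_n-k_{n-1})}{k_n-k_{n-1}},\ \frac{\gcd(v_\pi(G_{l_m})-v_\pi(G_{l_{m-1}}),\,l_m-l_{m-1})}{l_m-l_{m-1}}\right\}.$$ -/

import Mathlib

noncomputable section

/-- The `p`-adic valuation on `ℂ_[p]`, normalized by `v_p(p) = 1`, with `v_p(0) = ∞`. -/
def vp {p : ℕ} [Fact p.Prime] (x : ℂ_[p]) : EReal :=
  open Classical in if x = 0 then ⊤ else ((-Real.logb (p : ℝ) ‖x‖ : ℝ) : EReal)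

/-- The circle `C(t) = {x ∈ ℂ_[p] : v_p(x) = t}`. -/
def circleC (p : ℕ) [Fact p.Prime] (t : EReal) : Set ℂ_[p] := {x | vp x = t}

/-- The power series `F` converges at the point `x`. -/
def ConvergesAt {p : ℕ} [Fact p.Prime] (F : PowerSeries ℂ_[p]) (x : ℂ_[p]) : Prop :=
  Summable fun i : ℕ => PowerSeries.coeff i F * x ^ i

/-- The value `F(x) = ∑ F_i x ^ i`, meaningful where `F` converges. -/
def psEval {p : ℕ} [Fact p.Prime] (F : PowerSeries ℂ_[p]) (x : ℂ_[p]) : ℂ_[p] :=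
  ∑' i : ℕ, PowerSeries.coeff i F * x ^ i

/-- `φ(x) = min(v_p(F(x)), v_p(G(x)))`. -/
def phi {p : ℕ} [Fact p.Prime] (F G : PowerSeries ℂ_[p]) (x : ℂ_[p]) : EReal :=
  min (vp (psEval F x)) (vp (psEval G x))

/-- `(v_p(F_j) - v_p(F_i)) / (i - j)`, used for `j < i` and `F_j ≠ 0`; it is `-∞` if `F_i = 0`. -/
def quot {p : ℕ} [Fact p.Prime] (F : PowerSeries ℂ_[p]) (j i : ℕ) : EReal :=
  (vp (PowerSeries.coeff j F) - vp (PowerSeries.coeff i F)) / (((i : ℝ) - (j : ℝ) : ℝ) : EReal)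

/-- `k` is the term that follows `j` in the characteristic sequence: the largest of the integers
`i > j` at which `quot F j` is maximal. There is none if infinitely many integers attain the
maximum, or if the maximum is not attained: then the sequence ends with `j`. -/
def IsNextIndex {p : ℕ} [Fact p.Prime] (F : PowerSeries ℂ_[p]) (j k : ℕ) : Prop :=
  IsGreatest {i : ℕ | j < i ∧ ∀ i' : ℕ, j < i' → quot F j i' ≤ quot F j i} k

/-- `k 0, …, k n` are the first `n + 1` terms of the characteristic sequence of `F` (in particular
that sequence has at least `n + 1` terms). The first term is the least index of a nonzero
coefficient, which is `0` if `F(0) ≠ 0`. -/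
def IsCharSeq {p : ℕ} [Fact p.Prime] (F : PowerSeries ℂ_[p]) (k : ℕ → ℕ) (n : ℕ) : Prop :=
  IsLeast {i : ℕ | PowerSeries.coeff i F ≠ 0} (k 0) ∧ ∀ i < n, IsNextIndex F (k i) (k (i + 1))

/-- `α_n = (v_p(F_{k_{n-1}}) - v_p(F_{k_n})) / (k_n - k_{n-1})`, for `n ≥ 1`. -/
def rootVal {p : ℕ} [Fact p.Prime] (F : PowerSeries ℂ_[p]) (k : ℕ → ℕ) (n : ℕ) : EReal :=
  quot F (k (n - 1)) (k n)

/-- `v_p(F_{k_n}) + k_{n-1} α_n`, for `n ≥ 1`. -/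
def shiftedVal {p : ℕ} [Fact p.Prime] (F : PowerSeries ℂ_[p]) (k : ℕ → ℕ) (n : ℕ) : EReal :=
  vp (PowerSeries.coeff (k n) F) + (((k (n - 1) : ℕ) : ℝ) : EReal) * rootVal F k n

/-- The distinguished polynomial of `F` in the circle `C(t)`: the product of `X - z` over the zeros
`z` of `F` with `v_p(z) = t`, each repeated according to its multiplicity. -/
def circlePoly {p : ℕ} [Fact p.Prime] (F : PowerSeries ℂ_[p]) (t : EReal) : Polynomial ℂ_[p] :=
  ∏ᶠ z ∈ {z : ℂ_[p] | z ∈ circleC p t ∧ psEval F z = 0},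
    (Polynomial.X - Polynomial.C z) ^ analyticOrderNatAt (psEval F) z

/-- `ϖ` is a uniformizer of `K`: a generator of the maximal ideal of its ring of integers. -/
def IsUnif {p : ℕ} [Fact p.Prime] (K : IntermediateField ℚ_[p] ℂ_[p]) (ϖ : ℂ_[p]) : Prop :=
  ϖ ∈ K ∧ ϖ ≠ 0 ∧ ‖ϖ‖ < 1 ∧ ∀ x ∈ K, ‖x‖ < 1 → ‖x‖ ≤ ‖ϖ‖

/-- The `ϖ`-adic valuation `v_ϖ(x)` of a nonzero `x ∈ K`, where `ϖ` is a uniformizer of `K`: the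
unique integer `d` with `|x| = |ϖ| ^ d`. -/
def vPi {p : ℕ} [Fact p.Prime] (ϖ x : ℂ_[p]) : ℤ :=
  open Classical in if h : ∃ d : ℤ, ‖x‖ = ‖ϖ‖ ^ d then h.choose else 0

/-- `gcd(v_ϖ(F_{k_n}) - v_ϖ(F_{k_{n-1}}), k_n - k_{n-1}) / (k_n - k_{n-1})`, for `n ≥ 1`. -/
def gcdRatio {p : ℕ} [Fact p.Prime] (ϖ : ℂ_[p]) (F : PowerSeries ℂ_[p]) (k : ℕ → ℕ) (n : ℕ) : ℝ :=
  (Int.gcd (vPi ϖ (PowerSeries.coeff (k n) F) - vPi ϖ (PowerSeries.coeff (k (n - 1)) F))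
      ((k n : ℤ) - (k (n - 1) : ℤ)) : ℝ) /
    ((k n : ℝ) - (k (n - 1) : ℝ))

end

/-!
On the circle of radius `ρ = p ^ (-α)` the term of index `k_n` of `F` is the last of greatest norm
and the one of index `k_{n-1}` the first. Hence `F` is the product of a polynomial with
`k_n - k_{n-1}` roots, all on the circle, and of a series of constant norm there: up to a constant,
`|F(x)|` is the product `D_F(x)` of the distances from `x` to these roots. Moving `x` to the nearest
root of `F` or `G` does not increase `D_F(x)` or `D_G(x)`, so `φ` attains its maximum at a root.
The absolute value `R` of the resultant is the product of `D_G(z)` over the roots `z` of `F`, as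
well as that of `D_F(w)` over the roots `w` of `G`.

* Some root `z` of `F` has `D_G(z) ≤ R ^ (1 / (k_n - k_{n-1}))`, which is the lower bound.
* In the unit disc `D_G(z) ≤ 1` for all `z`, so each factor satisfies `R ≤ D_G(z)`, which is the
  upper bound.
* Over `K`, the factor `D_G(z)` is the same for all conjugates of `z`, so `R ≤ D_G(z) ^ d` where `d`
  is the degree of `z`. The norm of the constant term of the minimal polynomial of `z` is `ρ ^ d`
  and lies in the value group of `K`, which forces `1 / d ≤ c`. The roots are made algebraic by
  truncating `F` and `G`, which does not change `R`.
-/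

open Filter Topology PowerSeries
open Finset.HasAntidiagonal (antidiagonal mem_antidiagonal)

section DominantRange

variable {𝕜 : Type*} [NormedField 𝕜] {ρ : ℝ} {f g : PowerSeries 𝕜} {s t s' t' : ℕ}

/-- The norm of the `i`-th term of `f` on the circle of radius `ρ`. -/
noncomputable def weight (ρ : ℝ) (f : PowerSeries 𝕜) (i : ℕ) : ℝ := ‖coeff i f‖ * ρ ^ i

/-- On the circle of radius `ρ` the terms of `f` of greatest norm have their indices between `s`
and `t`, and the terms `s` and `t` are among them. If `s < t`, this is the projection to the
horizontal axis of the side of the Newton polygon of `f` that belongs to the radius `ρ`. -/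
structure IsDominantRange (ρ : ℝ) (f : PowerSeries 𝕜) (s t : ℕ) : Prop where
  weight_pos : 0 < weight ρ f s
  weight_eq : weight ρ f t = weight ρ f s
  weight_le : ∀ i, weight ρ f i ≤ weight ρ f s
  weight_lt_of_lt : ∀ i < s, weight ρ f i < weight ρ f s
  weight_lt_of_gt : ∀ i, t < i → weight ρ f i < weight ρ f s

theorem weight_nonneg (hρ : 0 ≤ ρ) (f : PowerSeries 𝕜) (i : ℕ) : 0 ≤ weight ρ f i := by
  unfold weight; positivity

theorem norm_coeff_mul_pow {x : 𝕜} (hx : ‖x‖ = ρ) (i : ℕ) :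
    ‖coeff i f * x ^ i‖ = weight ρ f i := by
  rw [norm_mul, norm_pow, hx, weight]

namespace IsDominantRange

theorem index_le (h : IsDominantRange ρ f s t) : s ≤ t :=
  not_lt.1 fun hts => (h.weight_lt_of_lt t hts).ne h.weight_eq

theorem index_unique (h : IsDominantRange ρ f s t) (h' : IsDominantRange ρ f s' t') :
    s = s' ∧ t = t' := by
  have hM : weight ρ f s = weight ρ f s' := le_antisymm (h'.weight_le s) (h.weight_le s')
  constructor <;> apply le_antisymm <;> rw [← not_lt] <;> intro hlt
  · exact (h.weight_lt_of_lt s' hlt).ne hM.symm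
  · exact (h'.weight_lt_of_lt s hlt).ne hM
  · exact (h'.weight_lt_of_gt t hlt).ne (h.weight_eq.trans hM)
  · exact (h.weight_lt_of_gt t' hlt).ne (h'.weight_eq.trans hM.symm)

theorem coeff_left_ne_zero (h : IsDominantRange ρ f s t) : coeff s f ≠ 0 := by
  intro h₀
  simpa [weight, h₀] using h.weight_pos

theorem coeff_right_ne_zero (h : IsDominantRange ρ f s t) : coeff t f ≠ 0 := by
  intro h₀
  exact h.weight_pos.ne (h.weight_eq ▸ by simp [weight, h₀])

theorem exists_of_isRestricted (hf : IsRestricted ρ f) (hρ : 0 < ρ) (hf₀ : f ≠ 0) :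
    ∃ s t, IsDominantRange ρ f s t := by
  obtain ⟨i₀, hi₀⟩ := exists_coeff_ne_zero_iff_ne_zero.2 hf₀
  have hpos : 0 < weight ρ f i₀ := mul_pos (norm_pos_iff.2 hi₀) (pow_pos hρ _)
  have hfin : {i | weight ρ f i₀ ≤ weight ρ f i}.Finite := by
    have h := (tendsto_order.1 ((isRestricted_iff ρ f).1 hf)).2 _ hpos
    simpa [weight, eventually_cofinite] using h
  obtain ⟨j, hj, hmax⟩ := hfin.exists_maximalFor (weight ρ f) _ ⟨i₀, le_refl (weight ρ f i₀)⟩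
  have hle : ∀ i, weight ρ f i ≤ weight ρ f j := fun i =>
    (le_total (weight ρ f i₀) (weight ρ f i)).elim
      (fun hi => le_of_not_gt fun hlt => hlt.not_ge (hmax hi hlt.le)) fun hi => hi.trans hj
  have hfin' : {i | weight ρ f i = weight ρ f j}.Finite :=
    hfin.subset fun i hi => (hj : weight ρ f i₀ ≤ _).trans_eq (Eq.symm hi)
  obtain ⟨s, hs, hs'⟩ := hfin'.exists_minimal ⟨j, rfl⟩
  obtain ⟨t, ht, ht'⟩ := hfin'.exists_maximal ⟨j, rfl⟩
  rw [Set.mem_ofPred_eq] at hs ht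
  refine ⟨s, t, hs ▸ hpos.trans_le hj, ht.trans hs.symm, fun i => (hle i).trans_eq hs.symm,
    fun i hi => ?_, fun i hi => ?_⟩ <;> rw [hs] <;> refine (hle i).lt_of_ne fun h => hi.not_ge ?_
  · exact hs' h hi.le
  · exact ht' h hi.le

theorem weight_mul_lt (hf : IsDominantRange ρ f s t) (hg : IsDominantRange ρ g s' t')
    (hρ : 0 < ρ) {i j : ℕ} (h : (i < s ∨ t < i) ∨ (j < s' ∨ t' < j)) :
    weight ρ f i * weight ρ g j < weight ρ f s * weight ρ g s' := by
  rcases h with h | h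
  · exact mul_lt_mul_of_lt_of_le_of_nonneg_of_pos
      (h.elim (hf.weight_lt_of_lt i) (hf.weight_lt_of_gt i)) (hg.weight_le j)
      (weight_nonneg hρ.le f i) hg.weight_pos
  · exact mul_lt_mul_of_le_of_lt_of_nonneg_of_pos (hf.weight_le i)
      (h.elim (hg.weight_lt_of_lt j) (hg.weight_lt_of_gt j)) (weight_nonneg hρ.le g j)
      hf.weight_pos

end IsDominantRange

variable [IsUltrametricDist 𝕜]

theorem exists_weight_mul_le (hρ : 0 ≤ ρ) (f g : PowerSeries 𝕜) (n : ℕ) :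
    ∃ ij ∈ antidiagonal n, weight ρ (f * g) n ≤ weight ρ f ij.1 * weight ρ g ij.2 := by
  obtain ⟨ij, hij, hle⟩ := IsUltrametricDist.exists_norm_finsetSum_le_of_nonempty
    (t := antidiagonal n) ⟨(0, n), by simp⟩ fun ij => coeff ij.1 f * coeff ij.2 g
  refine ⟨ij, hij, ?_⟩
  rw [weight, coeff_mul, weight, weight, mul_mul_mul_comm, ← pow_add, ← norm_mul,
    mem_antidiagonal.1 hij]
  gcongr

theorem norm_sum_eq_of_forall_lt {ι : Type*} {S : Finset ι} {u : ι → 𝕜} {a : ι} (ha : a ∈ S)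
    (h : ∀ i ∈ S, i ≠ a → ‖u i‖ < ‖u a‖) : ‖∑ i ∈ S, u i‖ = ‖u a‖ := by
  classical
  rcases (S.erase a).eq_empty_or_nonempty with h₀ | h₀
  · rw [← Finset.add_sum_erase S u ha, h₀, Finset.sum_empty, add_zero]
  · obtain ⟨j, hj, hle⟩ := IsUltrametricDist.exists_norm_finsetSum_le_of_nonempty h₀ u
    have hlt : ‖∑ i ∈ S.erase a, u i‖ < ‖u a‖ :=
      hle.trans_lt (h j (Finset.mem_of_mem_erase hj) (Finset.ne_of_mem_erase hj))
    rw [← Finset.add_sum_erase S u ha, IsUltrametricDist.norm_add_eq_max_of_norm_ne_norm hlt.ne',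
      max_eq_left hlt.le]

theorem norm_coeff_mul_of_forall_lt (hρ : 0 < ρ)
    (h : ∀ i j, i + j = s + t → (i, j) ≠ (s, t) →
      weight ρ f i * weight ρ g j < weight ρ f s * weight ρ g t) :
    ‖coeff (s + t) (f * g)‖ = ‖coeff s f‖ * ‖coeff t g‖ := by
  rw [coeff_mul, ← norm_mul]
  refine norm_sum_eq_of_forall_lt (a := (s, t)) (mem_antidiagonal.2 rfl) ?_
  rintro ⟨i, j⟩ hij hne
  have hij' := mem_antidiagonal.1 hij
  have hlt := h i j hij' hne
  rw [weight, weight, weight, weight, mul_mul_mul_comm, mul_mul_mul_comm ‖coeff s f‖, ← pow_add,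
    ← pow_add, hij', ← norm_mul, ← norm_mul] at hlt
  exact lt_of_mul_lt_mul_right hlt (pow_pos hρ _).le

namespace IsDominantRange

theorem norm_coeff_mul_left (hf : IsDominantRange ρ f s t) (hg : IsDominantRange ρ g s' t')
    (hρ : 0 < ρ) : ‖coeff (s + s') (f * g)‖ = ‖coeff s f‖ * ‖coeff s' g‖ :=
  norm_coeff_mul_of_forall_lt hρ fun i j hij hne => hf.weight_mul_lt hg hρ <| by
    by_contra! h
    exact hne (by ext <;> omega)

theorem norm_coeff_mul_right (hf : IsDominantRange ρ f s t) (hg : IsDominantRange ρ g s' t')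
    (hρ : 0 < ρ) : ‖coeff (t + t') (f * g)‖ = ‖coeff t f‖ * ‖coeff t' g‖ :=
  norm_coeff_mul_of_forall_lt hρ fun i j hij hne => by
    rw [hf.weight_eq, hg.weight_eq]
    refine hf.weight_mul_lt hg hρ ?_
    by_contra! h
    exact hne (by ext <;> omega)

theorem mul (hf : IsDominantRange ρ f s t) (hg : IsDominantRange ρ g s' t') (hρ : 0 < ρ) :
    IsDominantRange ρ (f * g) (s + s') (t + t') := by
  have hleft : weight ρ (f * g) (s + s') = weight ρ f s * weight ρ g s' := by
    rw [weight, hf.norm_coeff_mul_left hg hρ, pow_add, mul_mul_mul_comm]; rfl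
  have hright : weight ρ (f * g) (t + t') = weight ρ f t * weight ρ g t' := by
    rw [weight, hf.norm_coeff_mul_right hg hρ, pow_add, mul_mul_mul_comm]; rfl
  have hlt : ∀ n, n < s + s' ∨ t + t' < n → weight ρ (f * g) n < weight ρ (f * g) (s + s') := by
    intro n hn
    obtain ⟨⟨i, j⟩, hij, hle⟩ := exists_weight_mul_le hρ.le f g n
    rw [mem_antidiagonal] at hij
    exact hle.trans_lt (hleft ▸ hf.weight_mul_lt hg hρ (by dsimp only at *; omega))
  refine ⟨hleft ▸ mul_pos hf.weight_pos hg.weight_pos, ?_, fun n => ?_,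
    fun n hn => hlt n (.inl hn), fun n hn => hlt n (.inr hn)⟩
  · rw [hleft, hright, hf.weight_eq, hg.weight_eq]
  · obtain ⟨ij, -, hle⟩ := exists_weight_mul_le hρ.le f g n
    exact hle.trans (hleft ▸ mul_le_mul (hf.weight_le _) (hg.weight_le _)
      (weight_nonneg hρ.le g _) hf.weight_pos.le)

end IsDominantRange

end DominantRange

section OfRoots

variable {R : Type*} [CommRing R]

/-- The monic polynomial whose roots, with multiplicity, are the elements of `Z`. -/
noncomputable def ofRoots (Z : Multiset R) : Polynomial R :=
  (Z.map fun z => Polynomial.X - Polynomial.C z).prod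

@[simp]
theorem ofRoots_zero : ofRoots (0 : Multiset R) = 1 := by simp [ofRoots]

theorem ofRoots_cons (z : R) (Z : Multiset R) :
    ofRoots (z ::ₘ Z) = (Polynomial.X - Polynomial.C z) * ofRoots Z := by simp [ofRoots]

theorem coe_ofRoots_cons (z : R) (Z : Multiset R) :
    (ofRoots (z ::ₘ Z) : PowerSeries R) = (X - C z) * (ofRoots Z : PowerSeries R) := by
  simp [ofRoots_cons]

theorem monic_ofRoots (Z : Multiset R) : (ofRoots Z).Monic :=
  Polynomial.monic_multisetProd_X_sub_C Z

theorem roots_ofRoots [IsDomain R] (Z : Multiset R) : (ofRoots Z).roots = Z :=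
  Polynomial.roots_multiset_prod_X_sub_C Z

end OfRoots

section LinearFactor

variable {𝕜 : Type*} [NormedField 𝕜] {ρ : ℝ} {z : 𝕜}

theorem weight_X_sub_C (ρ : ℝ) (z : 𝕜) (i : ℕ) :
    weight ρ (X - C z) i = if i = 0 then ‖z‖ else if i = 1 then ρ else 0 := by
  rcases i with _ | _ | i <;> simp [weight, coeff_X]

theorem isDominantRange_X_sub_C_of_norm_eq (hρ : 0 < ρ) (hz : ‖z‖ = ρ) :
    IsDominantRange ρ (X - C z) 0 1 := by
  constructor <;> simp only [weight_X_sub_C, hz] <;> grind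

theorem isDominantRange_X_sub_C_of_lt_norm (hρ : 0 < ρ) (hz : ρ < ‖z‖) :
    IsDominantRange ρ (X - C z) 0 0 := by
  constructor <;> simp only [weight_X_sub_C] <;> grind

theorem isDominantRange_X_sub_C_of_norm_lt (hρ : 0 < ρ) (hz : ‖z‖ < ρ) :
    IsDominantRange ρ (X - C z) 1 1 := by
  constructor <;> simp only [weight_X_sub_C] <;> grind [norm_nonneg z]

theorem isDominantRange_C {a : 𝕜} (ha : a ≠ 0) : IsDominantRange ρ (C a) 0 0 := by
  have hw : ∀ i, weight ρ (C a) i = if i = 0 then ‖a‖ else 0 := fun i => by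
    rcases i with _ | i <;> simp [weight, coeff_C]
  have := norm_pos_iff.2 ha
  constructor <;> simp only [hw] <;> grind

theorem isDominantRange_one : IsDominantRange ρ (1 : PowerSeries 𝕜) 0 0 := by
  simpa using isDominantRange_C (ρ := ρ) (one_ne_zero (α := 𝕜))

variable [IsUltrametricDist 𝕜]

theorem isDominantRange_ofRoots (hρ : 0 < ρ) {Z : Multiset 𝕜} (hZ : ∀ z ∈ Z, ‖z‖ = ρ) :
    IsDominantRange ρ (ofRoots Z : PowerSeries 𝕜) 0 Z.card := by
  induction Z using Multiset.induction_on with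
  | empty => simpa using isDominantRange_one
  | cons z Z ih =>
    rw [coe_ofRoots_cons, Multiset.card_cons, add_comm]
    exact (isDominantRange_X_sub_C_of_norm_eq hρ (hZ z (Multiset.mem_cons_self z Z))).mul
      (ih fun w hw => hZ w (Multiset.mem_cons_of_mem hw)) hρ

theorem exists_isDominantRange_ofRoots (hρ : 0 < ρ) {Z : Multiset 𝕜} (hZ : ∀ z ∈ Z, ‖z‖ ≠ ρ) :
    ∃ s, IsDominantRange ρ (ofRoots Z : PowerSeries 𝕜) s s := by
  induction Z using Multiset.induction_on with
  | empty => exact ⟨0, by simpa using isDominantRange_one⟩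
  | cons z Z ih =>
    obtain ⟨s, hs⟩ := ih fun w hw => hZ w (Multiset.mem_cons_of_mem hw)
    rw [coe_ofRoots_cons]
    rcases (hZ z (Multiset.mem_cons_self z Z)).lt_or_gt with hz | hz
    · exact ⟨_, (isDominantRange_X_sub_C_of_norm_lt hρ hz).mul hs hρ⟩
    · exact ⟨_, (isDominantRange_X_sub_C_of_lt_norm hρ hz).mul hs hρ⟩

end LinearFactor

section SeriesEval

variable {𝕜 : Type*} [NormedField 𝕜] {ρ : ℝ} {f g : PowerSeries 𝕜} {s : ℕ} {x : 𝕜}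

/-- The value `f(x) = ∑ f_i x ^ i`, meaningful where the series converges. -/
noncomputable def seriesEval (f : PowerSeries 𝕜) (x : 𝕜) : 𝕜 := ∑' i, coeff i f * x ^ i

theorem seriesEval_coe (P : Polynomial 𝕜) (x : 𝕜) :
    seriesEval (P : PowerSeries 𝕜) x = P.eval x := by
  rw [Polynomial.eval_eq_sum, Polynomial.sum, seriesEval]
  simp only [Polynomial.coeff_coe]
  exact tsum_eq_sum fun i hi => by rw [Polynomial.notMem_support_iff.1 hi, zero_mul]

theorem isRestricted_coe (ρ : ℝ) (P : Polynomial 𝕜) : IsRestricted ρ (P : PowerSeries 𝕜) := by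
  rw [isRestricted_iff']
  refine tendsto_const_nhds.congr' ?_
  filter_upwards [eventually_gt_atTop P.natDegree] with i hi
  rw [Polynomial.coeff_coe, Polynomial.coeff_eq_zero_of_natDegree_lt hi, norm_zero, zero_mul]

theorem isRestricted_of_summable (hx : ‖x‖ = ρ) (h : Summable fun i => coeff i f * x ^ i) :
    IsRestricted ρ f := by
  rw [isRestricted_iff']
  simpa [hx] using h.tendsto_atTop_zero.norm

variable [IsUltrametricDist 𝕜]

theorem tsum_mul_tsum_eq_tsum_sum_antidiagonal_of_ultrametric {a b : ℕ → 𝕜} (ha : Summable a)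
    (hb : Summable b) :
    (∑' i, a i) * (∑' j, b j) = ∑' n, ∑ ij ∈ antidiagonal n, a ij.1 * b ij.2 := by
  have : NonarchimedeanRing 𝕜 := ⟨NonarchimedeanAddGroup.is_nonarchimedean⟩
  have hab : Summable fun ij : ℕ × ℕ => a ij.1 * b ij.2 := ha.mul_of_nonarchimedean hb
  exact ha.tsum_mul_tsum_eq_tsum_sum_antidiagonal hb hab

variable [CompleteSpace 𝕜]

theorem summable_of_isRestricted (hf : IsRestricted ρ f) (hx : ‖x‖ = ρ) :
    Summable fun i => coeff i f * x ^ i := by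
  refine NonarchimedeanAddGroup.summable_of_tendsto_cofinite_zero ?_
  rw [tendsto_zero_iff_norm_tendsto_zero]
  exact ((isRestricted_iff ρ f).1 hf).congr fun i => (norm_coeff_mul_pow hx i).symm

theorem seriesEval_add (hf : IsRestricted ρ f) (hg : IsRestricted ρ g) (hx : ‖x‖ = ρ) :
    seriesEval (f + g) x = seriesEval f x + seriesEval g x := by
  simp only [seriesEval, map_add, add_mul]
  exact (summable_of_isRestricted hf hx).tsum_add (summable_of_isRestricted hg hx)

theorem seriesEval_mul (hf : IsRestricted ρ f) (hg : IsRestricted ρ g) (hx : ‖x‖ = ρ) :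
    seriesEval (f * g) x = seriesEval f x * seriesEval g x := by
  refine Eq.trans (tsum_congr fun n => ?_) (tsum_mul_tsum_eq_tsum_sum_antidiagonal_of_ultrametric
    (summable_of_isRestricted hf hx) (summable_of_isRestricted hg hx)).symm
  rw [coeff_mul, Finset.sum_mul]
  refine Finset.sum_congr rfl fun ij hij => ?_
  rw [← mem_antidiagonal.1 hij, pow_add, mul_mul_mul_comm]

theorem IsDominantRange.norm_seriesEval (h : IsDominantRange ρ f s s) (hf : IsRestricted ρ f)
    (hx : ‖x‖ = ρ) : ‖seriesEval f x‖ = weight ρ f s := by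
  refine tendsto_nhds_unique (summable_of_isRestricted hf hx).hasSum.norm
    (tendsto_const_nhds.congr' ?_)
  filter_upwards [eventually_ge_atTop {s}] with S hS
  rw [norm_sum_eq_of_forall_lt (hS (Finset.mem_singleton_self s)), norm_coeff_mul_pow hx]
  intro i _ hi
  rw [norm_coeff_mul_pow hx, norm_coeff_mul_pow hx]
  exact hi.lt_or_gt.elim (h.weight_lt_of_lt i) (h.weight_lt_of_gt i)

end SeriesEval

section Division

variable {𝕜 : Type*} [NormedField 𝕜] {ρ : ℝ} {f : PowerSeries 𝕜} {z : 𝕜}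

/-- The quotient of `f - f(z)` by `X - z`; its `j`-th coefficient is `∑ f_{i+j+1} z ^ i`. -/
noncomputable def divXSubC (f : PowerSeries 𝕜) (z : 𝕜) : PowerSeries 𝕜 :=
  mk fun j => ∑' i, coeff (i + (j + 1)) f * z ^ i

theorem pow_mul_coeff_divXSubC (f : PowerSeries 𝕜) (z : 𝕜) (j : ℕ) :
    z ^ (j + 1) * coeff j (divXSubC f z) =
      ∑' i, coeff (i + (j + 1)) f * z ^ (i + (j + 1)) := by
  rw [divXSubC, coeff_mk, ← tsum_mul_left]
  exact tsum_congr fun i => by ring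

theorem isRestricted_divXSubC (hρ : 0 < ρ) (hz : ‖z‖ = ρ) : IsRestricted ρ (divXSubC f z) := by
  rw [isRestricted_iff']
  have htail := ((tendsto_sum_nat_add fun i => coeff i f * z ^ i).comp
    (tendsto_add_atTop_nat 1)).norm.const_mul ρ⁻¹
  rw [norm_zero, mul_zero] at htail
  refine htail.congr fun j => ?_
  rw [Function.comp_apply, ← pow_mul_coeff_divXSubC, norm_mul, norm_pow, hz]
  field

variable [IsUltrametricDist 𝕜] [CompleteSpace 𝕜]

theorem coeff_divXSubC (hρ : 0 < ρ) (hf : IsRestricted ρ f) (hz : ‖z‖ = ρ) (j : ℕ) :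
    coeff j (divXSubC f z) = coeff (j + 1) f + z * coeff (j + 1) (divXSubC f z) := by
  have hz₀ : z ^ (j + 1) ≠ 0 := pow_ne_zero _ (norm_pos_iff.1 (hz ▸ hρ))
  have hs : Summable fun i => coeff i f * z ^ i := summable_of_isRestricted hf hz
  have htail := (summable_nat_add_iff (j + 1)).2 hs
  refine mul_left_cancel₀ hz₀ ?_
  rw [mul_add, ← mul_assoc, ← pow_succ, pow_mul_coeff_divXSubC, pow_mul_coeff_divXSubC,
    htail.tsum_eq_zero_add]
  simp only [zero_add, mul_comm, add_assoc, add_comm 1]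

theorem X_sub_C_mul_divXSubC (hρ : 0 < ρ) (hf : IsRestricted ρ f) (hz : ‖z‖ = ρ) :
    (X - C z) * divXSubC f z = f - C (seriesEval f z) := by
  ext n
  rw [sub_mul, map_sub, map_sub, coeff_C_mul, coeff_C]
  rcases n with _ | n
  · have hvalue : seriesEval f z = coeff 0 f + z * coeff 0 (divXSubC f z) := by
      rw [seriesEval, (summable_of_isRestricted hf hz).tsum_eq_zero_add, pow_zero, mul_one]
      simpa using (pow_mul_coeff_divXSubC f z 0).symm
    rw [coeff_zero_X_mul, if_pos rfl, hvalue]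
    ring
  · rw [coeff_succ_X_mul, if_neg n.succ_ne_zero, sub_zero, coeff_divXSubC hρ hf hz]
    ring

theorem X_sub_C_mul_divXSubC_of_root (hρ : 0 < ρ) (hf : IsRestricted ρ f) (hz : ‖z‖ = ρ)
    (h₀ : seriesEval f z = 0) : (X - C z) * divXSubC f z = f := by
  rw [X_sub_C_mul_divXSubC hρ hf hz, h₀, map_zero, sub_zero]

theorem IsDominantRange.exists_divXSubC {s t : ℕ} (h : IsDominantRange ρ f s t) (hρ : 0 < ρ)
    (hf : IsRestricted ρ f) (hz : ‖z‖ = ρ) (h₀ : seriesEval f z = 0) :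
    ∃ u, t = u + 1 ∧ IsDominantRange ρ (divXSubC f z) s u := by
  have hfac := X_sub_C_mul_divXSubC_of_root hρ hf hz h₀
  have hne : divXSubC f z ≠ 0 := fun h₁ => by
    rw [h₁, mul_zero] at hfac
    simpa [weight, ← hfac] using h.weight_pos
  obtain ⟨s', u, hu⟩ :=
    IsDominantRange.exists_of_isRestricted (isRestricted_divXSubC hρ hz) hρ hne
  have hprod := (isDominantRange_X_sub_C_of_norm_eq hρ hz).mul hu hρ
  rw [hfac, zero_add, add_comm 1] at hprod
  obtain ⟨rfl, ht⟩ := h.index_unique hprod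
  exact ⟨u, ht, hu⟩

end Division

section CircleFactorization

variable {𝕜 : Type*} [NormedField 𝕜] {ρ : ℝ} {f u : PowerSeries 𝕜} {Z : Multiset 𝕜} {s t : ℕ}

/-- The product of the distances from `x` to the elements of `Z`. -/
def distProd (Z : Multiset 𝕜) (x : 𝕜) : ℝ := (Z.map fun z => ‖x - z‖).prod

@[simp]
theorem distProd_zero (x : 𝕜) : distProd 0 x = 1 := by simp [distProd]

@[simp]
theorem distProd_cons (z : 𝕜) (Z : Multiset 𝕜) (x : 𝕜) :
    distProd (z ::ₘ Z) x = ‖x - z‖ * distProd Z x := by simp [distProd]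

theorem norm_eval_ofRoots (Z : Multiset 𝕜) (x : 𝕜) : ‖(ofRoots Z).eval x‖ = distProd Z x := by
  induction Z using Multiset.induction_on with
  | empty => simp
  | cons z Z ih => simp [ofRoots_cons, ih]

theorem distProd_nonneg (Z : Multiset 𝕜) (x : 𝕜) : 0 ≤ distProd Z x :=
  Multiset.prod_map_nonneg fun _ _ => norm_nonneg _

theorem distProd_eq_zero_iff {x : 𝕜} : distProd Z x = 0 ↔ x ∈ Z := by
  simp [distProd, Multiset.prod_eq_zero_iff, sub_eq_zero]

/-- A factorization `f = ∏ (X - z) * u`, `z ∈ Z`, in which `Z` lies on the circle of radius `ρ`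
and `u` has a single term of greatest norm there, of index `s`. Then `u` does not vanish on the
circle, so that the elements of `Z` are the zeros of `f` on it, with multiplicity. -/
structure IsCircleFactorization (ρ : ℝ) (f : PowerSeries 𝕜) (Z : Multiset 𝕜) (u : PowerSeries 𝕜)
    (s : ℕ) : Prop where
  norm_eq : ∀ z ∈ Z, ‖z‖ = ρ
  isRestricted : IsRestricted ρ u
  isDominantRange : IsDominantRange ρ u s s
  eq_mul : f = ofRoots Z * u

theorem IsDominantRange.isCircleFactorization (hu : IsDominantRange ρ u s s)
    (hur : IsRestricted ρ u) : IsCircleFactorization ρ u 0 u s :=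
  ⟨by simp, hur, hu, by simp⟩

theorem IsCircleFactorization.X_sub_C_mul (h : IsCircleFactorization ρ f Z u s) {z : 𝕜}
    (hz : ‖z‖ = ρ) : IsCircleFactorization ρ ((X - C z) * f) (z ::ₘ Z) u s :=
  ⟨by simpa [hz] using h.norm_eq, h.isRestricted, h.isDominantRange, by
    rw [h.eq_mul, coe_ofRoots_cons, mul_assoc]⟩

variable [IsUltrametricDist 𝕜]

namespace IsCircleFactorization

theorem isDominantRange_mul (h : IsCircleFactorization ρ f Z u s) (hρ : 0 < ρ) :
    IsDominantRange ρ f s (Z.card + s) := by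
  simpa [h.eq_mul] using (isDominantRange_ofRoots hρ h.norm_eq).mul h.isDominantRange hρ

theorem norm_coeff (h : IsCircleFactorization ρ f Z u s) (hρ : 0 < ρ) :
    ‖coeff (Z.card + s) f‖ = ‖coeff s u‖ := by
  have hlead : (ofRoots Z).coeff Z.card = 1 := by
    simpa [ofRoots] using (monic_ofRoots Z).coeff_natDegree
  rw [h.eq_mul, (isDominantRange_ofRoots hρ h.norm_eq).norm_coeff_mul_right h.isDominantRange hρ,
    Polynomial.coeff_coe, hlead, norm_one, one_mul]

theorem card_eq_sub (h : IsCircleFactorization ρ f Z u s) (hρ : 0 < ρ) {s' : ℕ}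
    (hf : IsDominantRange ρ f s' t) : Z.card = t - s' := by
  obtain ⟨rfl, rfl⟩ := hf.index_unique (h.isDominantRange_mul hρ)
  exact (Nat.add_sub_cancel _ _).symm

theorem weight_eq (h : IsCircleFactorization ρ f Z u s) (hρ : 0 < ρ) {s' : ℕ}
    (hf : IsDominantRange ρ f s' t) : weight ρ u s = ‖coeff t f‖ * ρ ^ s' := by
  obtain ⟨rfl, rfl⟩ := hf.index_unique (h.isDominantRange_mul hρ)
  rw [h.norm_coeff hρ, weight]

variable [CompleteSpace 𝕜]

theorem seriesEval_eq (h : IsCircleFactorization ρ f Z u s) {x : 𝕜} (hx : ‖x‖ = ρ) :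
    seriesEval f x = (ofRoots Z).eval x * seriesEval u x := by
  rw [h.eq_mul, seriesEval_mul (isRestricted_coe ρ _) h.isRestricted hx, seriesEval_coe]

theorem norm_seriesEval (h : IsCircleFactorization ρ f Z u s) {x : 𝕜} (hx : ‖x‖ = ρ) :
    ‖seriesEval f x‖ = weight ρ u s * distProd Z x := by
  rw [h.seriesEval_eq hx, norm_mul, norm_eval_ofRoots,
    h.isDominantRange.norm_seriesEval h.isRestricted hx, mul_comm]

theorem seriesEval_eq_zero_iff (h : IsCircleFactorization ρ f Z u s) {x : 𝕜} (hx : ‖x‖ = ρ) :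
    seriesEval f x = 0 ↔ x ∈ Z := by
  rw [← norm_eq_zero, h.norm_seriesEval hx, mul_eq_zero,
    or_iff_right h.isDominantRange.weight_pos.ne', distProd_eq_zero_iff]

end IsCircleFactorization

end CircleFactorization

section Polynomial

variable {𝕜 : Type*} [NormedField 𝕜] [IsUltrametricDist 𝕜] {ρ : ℝ}

theorem exists_isCircleFactorization_polynomial [IsAlgClosed 𝕜]
    [DecidablePred fun z : 𝕜 => ‖z‖ = ρ] (hρ : 0 < ρ) {P : Polynomial 𝕜} (hP : P ≠ 0) :
    ∃ u s, IsCircleFactorization ρ P (P.roots.filter (‖·‖ = ρ)) u s := by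
  set Z := P.roots.filter (‖·‖ = ρ)
  set W := P.roots.filter (¬‖·‖ = ρ)
  obtain ⟨s, hs⟩ := exists_isDominantRange_ofRoots hρ (Z := W) fun z hz =>
    (Multiset.mem_filter.1 hz).2
  have hP_eq : P = ofRoots Z * (Polynomial.C P.leadingCoeff * ofRoots W) := by
    conv_lhs => rw [(IsAlgClosed.splits P).eq_prod_roots,
      ← Multiset.filter_add_not (‖·‖ = ρ) P.roots, Multiset.map_add, Multiset.prod_add,
      mul_left_comm]
    rfl
  refine ⟨_, 0 + s, fun z hz => (Multiset.mem_filter.1 hz).2,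
    isRestricted_coe ρ (Polynomial.C P.leadingCoeff * ofRoots W), ?_, by exact_mod_cast hP_eq⟩
  rw [Polynomial.coe_mul, Polynomial.coe_C]
  exact (isDominantRange_C (Polynomial.leadingCoeff_ne_zero.2 hP)).mul hs hρ

end Polynomial

section Analytic

variable {𝕜 : Type*} [NormedField 𝕜] {ρ M : ℝ} {f : PowerSeries 𝕜} {x z : 𝕜}

/-- The `n`-th coefficient of the expansion of `f` at `z`. -/
noncomputable def taylorCoeff (f : PowerSeries 𝕜) (z : 𝕜) (n : ℕ) : 𝕜 :=
  seriesEval ((divXSubC · z)^[n] f) z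

theorem exists_weight_le (hf : IsRestricted ρ f) : ∃ M, ∀ i, weight ρ f i ≤ M := by
  obtain ⟨M, hM⟩ := ((isRestricted_iff' ρ f).1 hf).bddAbove_range
  exact ⟨M, fun i => hM ⟨i, rfl⟩⟩

theorem isRestricted_divXSubC_iterate (hρ : 0 < ρ) (hf : IsRestricted ρ f) (hz : ‖z‖ = ρ) (n : ℕ) :
    IsRestricted ρ ((divXSubC · z)^[n] f) := by
  cases n with
  | zero => exact hf
  | succ n =>
    rw [Function.iterate_succ_apply']
    exact isRestricted_divXSubC hρ hz

variable [IsUltrametricDist 𝕜]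

theorem norm_eq_of_norm_sub_lt (h : ‖x - z‖ < ‖z‖) : ‖x‖ = ‖z‖ := by
  rw [← norm_neg z]
  refine IsUltrametricDist.norm_eq_of_add_norm_lt_max ?_
  rw [← sub_eq_add_neg, norm_neg]
  exact h.trans_le (le_max_right _ _)

theorem norm_seriesEval_le (hM : ∀ i, weight ρ f i ≤ M) (hx : ‖x‖ = ρ) : ‖seriesEval f x‖ ≤ M :=
  IsUltrametricDist.norm_tsum_le_of_forall_le_of_nonneg
    ((hx ▸ weight_nonneg (norm_nonneg x) f 0).trans (hM 0))
    fun i => (norm_coeff_mul_pow hx i).trans_le (hM i)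

theorem weight_divXSubC_le (hρ : 0 < ρ) (hM : ∀ i, weight ρ f i ≤ M) (hz : ‖z‖ = ρ) (j : ℕ) :
    weight ρ (divXSubC f z) j ≤ M / ρ := by
  rw [le_div_iff₀ hρ]
  calc weight ρ (divXSubC f z) j * ρ = ‖z ^ (j + 1) * coeff j (divXSubC f z)‖ := by
        rw [norm_mul, norm_pow, hz, weight]; ring
    _ ≤ M := by
        rw [pow_mul_coeff_divXSubC]
        exact IsUltrametricDist.norm_tsum_le_of_forall_le_of_nonneg
          ((weight_nonneg hρ.le f 0).trans (hM 0))
          fun i => (norm_coeff_mul_pow hz _).trans_le (hM _)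

theorem weight_divXSubC_iterate_le (hρ : 0 < ρ) (hM : ∀ i, weight ρ f i ≤ M) (hz : ‖z‖ = ρ)
    (n i : ℕ) : weight ρ ((divXSubC · z)^[n] f) i ≤ M / ρ ^ n := by
  induction n generalizing i with
  | zero => simpa using hM i
  | succ n ih =>
    rw [Function.iterate_succ_apply', pow_succ, ← div_div]
    exact weight_divXSubC_le hρ ih hz i

variable [CompleteSpace 𝕜]

theorem seriesEval_eq_add_mul_divXSubC (hρ : 0 < ρ) (hf : IsRestricted ρ f) (hz : ‖z‖ = ρ)
    (hx : ‖x‖ = ρ) :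
    seriesEval f x = seriesEval f z + (x - z) * seriesEval (divXSubC f z) x := by
  have hfac : f = ((Polynomial.C (seriesEval f z) : Polynomial 𝕜) : PowerSeries 𝕜) +
      ((Polynomial.X - Polynomial.C z : Polynomial 𝕜) : PowerSeries 𝕜) * divXSubC f z := by
    simp [X_sub_C_mul_divXSubC hρ hf hz]
  have hq := isRestricted_divXSubC (f := f) hρ hz
  conv_lhs => rw [hfac]
  rw [seriesEval_add (isRestricted_coe ρ _) (isRestricted.mul ρ (isRestricted_coe ρ _) hq) hx,
    seriesEval_mul (isRestricted_coe ρ _) hq hx, seriesEval_coe, seriesEval_coe]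
  simp

theorem seriesEval_eq_sum_taylorCoeff_add (hρ : 0 < ρ) (hf : IsRestricted ρ f) (hz : ‖z‖ = ρ)
    (hx : ‖x‖ = ρ) (n : ℕ) :
    seriesEval f x = ∑ k ∈ Finset.range n, taylorCoeff f z k * (x - z) ^ k +
      (x - z) ^ n * seriesEval ((divXSubC · z)^[n] f) x := by
  induction n with
  | zero => simp
  | succ n ih =>
    rw [ih, Finset.sum_range_succ, Function.iterate_succ_apply', taylorCoeff,
      seriesEval_eq_add_mul_divXSubC hρ (isRestricted_divXSubC_iterate hρ hf hz n) hz hx]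
    ring

theorem hasSum_taylorCoeff (hρ : 0 < ρ) (hf : IsRestricted ρ f) (hz : ‖z‖ = ρ)
    (hxz : ‖x - z‖ < ρ) :
    HasSum (fun n => taylorCoeff f z n * (x - z) ^ n) (seriesEval f x) := by
  obtain ⟨M, hM⟩ := exists_weight_le hf
  have hx : ‖x‖ = ρ := (norm_eq_of_norm_sub_lt (hz.symm ▸ hxz)).trans hz
  have hbound : ∀ y : 𝕜, ‖y‖ = ρ → ∀ n,
      ‖(x - z) ^ n * seriesEval ((divXSubC · z)^[n] f) y‖ ≤ M * (‖x - z‖ / ρ) ^ n := by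
    intro y hy n
    rw [norm_mul, norm_pow, div_pow, mul_div_left_comm]
    gcongr
    exact norm_seriesEval_le (weight_divXSubC_iterate_le hρ hM hz n) hy
  have hgeom : ‖x - z‖ / ρ < 1 := (div_lt_one hρ).2 hxz
  have hsum : Summable fun n => taylorCoeff f z n * (x - z) ^ n :=
    ((summable_geometric_of_lt_one (by positivity) hgeom).mul_left M).of_norm_bounded
      fun n => by rw [mul_comm]; exact hbound z hz n
  have hrem : Tendsto (fun n => (x - z) ^ n * seriesEval ((divXSubC · z)^[n] f) x) atTop (𝓝 0) :=
    squeeze_zero_norm (hbound x hx) <| by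
      simpa using (tendsto_pow_atTop_nhds_zero_of_lt_one (by positivity) hgeom).const_mul M
  rw [hsum.hasSum_iff_tendsto_nat]
  simpa [← eq_sub_iff_add_eq.2 (seriesEval_eq_sum_taylorCoeff_add hρ hf hz hx _).symm] using
    hrem.const_sub (seriesEval f x)

end Analytic

theorem analyticAt_seriesEval {𝕜 : Type*} [NontriviallyNormedField 𝕜] [IsUltrametricDist 𝕜]
    [CompleteSpace 𝕜] {ρ : ℝ} {f : PowerSeries 𝕜} {z : 𝕜} (hρ : 0 < ρ) (hf : IsRestricted ρ f)
    (hz : ‖z‖ = ρ) : AnalyticAt 𝕜 (seriesEval f) z := by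
  refine ⟨FormalMultilinearSeries.ofScalars 𝕜 (taylorCoeff f z), hasFPowerSeriesAt_iff.2 ?_⟩
  filter_upwards [Metric.ball_mem_nhds 0 hρ] with y hy
  have hs := hasSum_taylorCoeff (x := z + y) hρ hf hz (by simpa using hy)
  simpa [FormalMultilinearSeries.coeff_ofScalars, mul_comm] using hs

section Zeros

theorem max_norm_eq_of_norm_sub_le {E : Type*} [SeminormedAddCommGroup E] [IsUltrametricDist E]
    {a b : E} {ε : ℝ} (h : ‖a - b‖ ≤ ε) : max ‖a‖ ε = max ‖b‖ ε := by
  have hle : ∀ {a b : E}, ‖a - b‖ ≤ ε → max ‖a‖ ε ≤ max ‖b‖ ε := fun {a b} h => by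
    refine max_le ?_ (le_max_right _ _)
    calc ‖a‖ ≤ max ‖a - b‖ ‖b‖ := by simpa [dist_eq_norm] using dist_triangle_max a b 0
      _ ≤ max ‖b‖ ε := max_comm ‖b‖ ε ▸ max_le_max_right _ h
  exact (hle h).antisymm (hle (norm_sub_rev a b ▸ h))

variable {𝕜 : Type*} [NormedField 𝕜] {Z : Multiset 𝕜}

theorem pow_card_le_distProd {r : ℝ} (hr : 0 ≤ r) {x : 𝕜} (h : ∀ z ∈ Z, r ≤ ‖x - z‖) :
    r ^ Z.card ≤ distProd Z x := by
  simpa [distProd] using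
    Multiset.prod_map_le_prod_map₀ (fun _ => r) (fun z => ‖x - z‖) (fun _ _ => hr) h

theorem exists_mem_forall_norm_sub_le (hZ : Z ≠ 0) (x : 𝕜) :
    ∃ z ∈ Z, ∀ w ∈ Z, ‖x - z‖ ≤ ‖x - w‖ := by
  classical
  simpa using Z.toFinset.exists_min_image (fun z => ‖x - z‖)
    (by simpa [Finset.nonempty_iff_ne_empty] using hZ)

theorem IsDominantRange.trunc {ρ : ℝ} {f : PowerSeries 𝕜} {s t N : ℕ} (h : IsDominantRange ρ f s t)
    (hρ : 0 ≤ ρ) (hN : t < N) : IsDominantRange ρ (trunc N f : PowerSeries 𝕜) s t := by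
  have hle : ∀ i, weight ρ (PowerSeries.trunc N f : PowerSeries 𝕜) i ≤ weight ρ f i := fun i => by
    rw [weight, Polynomial.coeff_coe, coeff_trunc]
    split_ifs
    · rfl
    · simpa using weight_nonneg hρ f i
  have heq : ∀ i ≤ t, weight ρ (PowerSeries.trunc N f : PowerSeries 𝕜) i = weight ρ f i :=
    fun i hi => by rw [weight, Polynomial.coeff_coe, coeff_trunc, if_pos (by omega), weight]
  have hs := heq s h.index_le
  constructor <;> rw [hs]
  · exact h.weight_pos
  · rw [heq t le_rfl, h.weight_eq]
  · exact fun i => (hle i).trans (h.weight_le i)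
  · exact fun i hi => (hle i).trans_lt (h.weight_lt_of_lt i hi)
  · exact fun i hi => (hle i).trans_lt (h.weight_lt_of_gt i hi)

variable [IsUltrametricDist 𝕜] [CompleteSpace 𝕜] {ρ : ℝ} {f : PowerSeries 𝕜} {s t : ℕ}

theorem norm_seriesEval_sub_trunc_le (hf : IsRestricted ρ f) {ε : ℝ} (hε : 0 ≤ ε) {N : ℕ}
    (hN : ∀ i, N ≤ i → weight ρ f i ≤ ε) {x : 𝕜} (hx : ‖x‖ = ρ) :
    ‖seriesEval f x - (trunc N f).eval x‖ ≤ ε := by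
  have hs : Summable fun i => coeff i f * x ^ i := summable_of_isRestricted hf hx
  rw [seriesEval, Polynomial.eval, eval₂_trunc_eq_sum_range, ← hs.sum_add_tsum_nat_add N]
  simp only [RingHom.id_apply, add_sub_cancel_left]
  exact IsUltrametricDist.norm_tsum_le_of_forall_le_of_nonneg hε fun i =>
    (norm_coeff_mul_pow hx _).trans_le (hN _ (by omega))

theorem exists_trunc_close (hf : IsRestricted ρ f) (t : ℕ) {ε : ℝ} (hε : 0 < ε) :
    ∃ N, t < N ∧ ∀ x, ‖x‖ = ρ → ‖seriesEval f x - (trunc N f).eval x‖ ≤ ε := by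
  obtain ⟨N, hN⟩ := ((((isRestricted_iff' ρ f).1 hf).eventually_lt_const hε).and
    (eventually_gt_atTop t)).exists_forall_of_atTop
  exact ⟨N, (hN N le_rfl).2, fun x hx =>
    norm_seriesEval_sub_trunc_le hf hε.le (fun i hi => (hN i hi).1.le) hx⟩

variable [IsAlgClosed 𝕜]

theorem IsDominantRange.exists_approx_zeros (h : IsDominantRange ρ f s t) (hρ : 0 < ρ)
    (hf : IsRestricted ρ f) {ε : ℝ} (hε : 0 < ε) :
    ∃ Z : Multiset 𝕜, Z.card = t - s ∧ (∀ z ∈ Z, ‖z‖ = ρ ∧ ‖seriesEval f z‖ ≤ ε) ∧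
      ∀ x, ‖x‖ = ρ → ‖coeff t f‖ * ρ ^ s * distProd Z x ≤ max ‖seriesEval f x‖ ε := by
  classical
  -- The approximate zeros are the zeros of a truncation of `f`.
  obtain ⟨N, htN, hclose⟩ := exists_trunc_close hf t hε
  set P := PowerSeries.trunc N f with hP
  have hdom : IsDominantRange ρ (P : PowerSeries 𝕜) s t := h.trunc hρ.le htN
  have hP₀ : P ≠ 0 := fun h₀ => hdom.coeff_left_ne_zero (by simp [h₀])
  have hcoeff : coeff t (P : PowerSeries 𝕜) = coeff t f := by
    rw [Polynomial.coeff_coe, coeff_trunc, if_pos htN]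
  obtain ⟨u, s', hfac⟩ := exists_isCircleFactorization_polynomial hρ hP₀
  refine ⟨_, hfac.card_eq_sub hρ hdom, fun z hz => ?_, fun x hx => ?_⟩
  · have hroot : P.eval z = 0 := (Polynomial.mem_roots'.1 (Multiset.mem_filter.1 hz).1).2
    have hzρ := hfac.norm_eq z hz
    exact ⟨hzρ, by simpa [← hP, hroot] using hclose z hzρ⟩
  · rw [← hcoeff, ← hfac.weight_eq hρ hdom, ← hfac.norm_seriesEval hx, seriesEval_coe,
      max_norm_eq_of_norm_sub_le (hclose x hx)]
    exact le_max_left _ _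

theorem IsDominantRange.exists_approx_zero_near (h : IsDominantRange ρ f s t) (hst : s < t)
    (hρ : 0 < ρ) (hf : IsRestricted ρ f) {ε ε' : ℝ} (hε' : 0 < ε') (hle : ε' ≤ ε) {x : 𝕜}
    (hx : ‖x‖ = ρ) (hfx : ‖seriesEval f x‖ ≤ ε) :
    ∃ z, ‖z‖ = ρ ∧ ‖seriesEval f z‖ ≤ ε' ∧
      ‖coeff t f‖ * ρ ^ s * ‖x - z‖ ^ (t - s) ≤ ε := by
  obtain ⟨Z, hcard, hZ, hdist⟩ := h.exists_approx_zeros hρ hf hε'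
  obtain ⟨z, hz, hnear⟩ := exists_mem_forall_norm_sub_le
    (Multiset.card_pos.1 (hcard ▸ Nat.sub_pos_of_lt hst)) x
  refine ⟨z, (hZ z hz).1, (hZ z hz).2, ?_⟩
  calc ‖coeff t f‖ * ρ ^ s * ‖x - z‖ ^ (t - s)
      ≤ ‖coeff t f‖ * ρ ^ s * distProd Z x := by
        rw [← hcard]
        gcongr
        exact pow_card_le_distProd (norm_nonneg _) hnear
    _ ≤ ε := (hdist x hx).trans (max_le hfx hle)

end Zeros

section Factorization

variable {𝕜 : Type*} [NontriviallyNormedField 𝕜] [IsUltrametricDist 𝕜] [CompleteSpace 𝕜]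
  [IsAlgClosed 𝕜] {ρ : ℝ} {f : PowerSeries 𝕜} {s t : ℕ}

theorem IsDominantRange.exists_approx_zero_seq (h : IsDominantRange ρ f s t) (hst : s < t)
    (hρ : 0 < ρ) (hf : IsRestricted ρ f) :
    ∃ z : ℕ → 𝕜, (∀ n, ‖z n‖ = ρ) ∧ Tendsto (fun n => seriesEval f (z n)) atTop (𝓝 0) ∧
      ∀ n, dist (z n) (z (n + 1)) ≤ 1 * (1 / 2 : ℝ) ^ n := by
  set c := ‖coeff t f‖ * ρ ^ s
  have hc : 0 < c := mul_pos (norm_pos_iff.2 h.coeff_right_ne_zero) (pow_pos hρ s)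
  set ε : ℕ → ℝ := fun n => c * ((1 / 2 : ℝ) ^ n) ^ (t - s) with hε_def
  have hε : ∀ n, 0 < ε n := fun n => by positivity
  have hε_anti : ∀ n, ε (n + 1) ≤ ε n := fun n => by
    simp only [hε_def, pow_succ (1 / 2 : ℝ) n]
    gcongr
    linarith [pow_pos (one_half_pos (α := ℝ)) n]
  have hε_lim : Tendsto ε atTop (𝓝 0) := by
    have hd : t - s ≠ 0 := by omega
    simpa [hε_def, hd] using ((tendsto_pow_atTop_nhds_zero_of_lt_one (r := (1 / 2 : ℝ))
      (by norm_num) (by norm_num)).pow (t - s)).const_mul c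
  obtain ⟨Z, hcard, hZ, -⟩ := h.exists_approx_zeros hρ hf (hε 0)
  obtain ⟨z₀, hz₀⟩ := Multiset.card_pos_iff_exists_mem.1 (hcard ▸ Nat.sub_pos_of_lt hst)
  choose! g hgρ hgε hgdist using fun n x (hx : ‖x‖ = ρ ∧ ‖seriesEval f x‖ ≤ ε n) =>
    h.exists_approx_zero_near hst hρ hf (hε (n + 1)) (hε_anti n) hx.1 hx.2
  let z : ℕ → 𝕜 := fun n => Nat.rec z₀ g n
  have hz : ∀ n, ‖z n‖ = ρ ∧ ‖seriesEval f (z n)‖ ≤ ε n := fun n => by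
    induction n with
    | zero => exact hZ z₀ hz₀
    | succ n ih => exact ⟨hgρ n _ ih, hgε n _ ih⟩
  refine ⟨z, fun n => (hz n).1, squeeze_zero_norm (fun n => (hz n).2) hε_lim, fun n => ?_⟩
  rw [one_mul, dist_eq_norm]
  exact le_of_pow_le_pow_left₀ (by omega) (by positivity)
    (le_of_mul_le_mul_left (hgdist n _ (hz n)) hc)

theorem IsDominantRange.exists_zero (h : IsDominantRange ρ f s t) (hst : s < t) (hρ : 0 < ρ)
    (hf : IsRestricted ρ f) : ∃ z, ‖z‖ = ρ ∧ seriesEval f z = 0 := by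
  obtain ⟨z, hzρ, hz₀, hdist⟩ := h.exists_approx_zero_seq hst hρ hf
  obtain ⟨w, hw⟩ := cauchySeq_tendsto_of_complete
    (cauchySeq_of_le_geometric (1 / 2) 1 (by norm_num) hdist)
  have hwρ : ‖w‖ = ρ := tendsto_nhds_unique hw.norm (by simp [hzρ])
  exact ⟨w, hwρ, tendsto_nhds_unique
    ((analyticAt_seriesEval hρ hf hwρ).continuousAt.tendsto.comp hw) hz₀⟩

theorem IsDominantRange.exists_isCircleFactorization (h : IsDominantRange ρ f s t) (hρ : 0 < ρ)
    (hf : IsRestricted ρ f) : ∃ Z u, IsCircleFactorization ρ f Z u s := by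
  obtain ⟨d, rfl⟩ := exists_add_of_le h.index_le
  induction d generalizing f with
  | zero => exact ⟨0, f, h.isCircleFactorization hf⟩
  | succ d ih =>
    obtain ⟨z, hz, h₀⟩ := h.exists_zero (by omega) hρ hf
    obtain ⟨u, hu, hdom⟩ := h.exists_divXSubC hρ hf hz h₀
    obtain rfl : u = s + d := by omega
    obtain ⟨Z, v, hfac⟩ := ih (isRestricted_divXSubC hρ hz) hdom
    exact ⟨z ::ₘ Z, v, X_sub_C_mul_divXSubC_of_root hρ hf hz h₀ ▸ hfac.X_sub_C_mul hz⟩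

end Factorization

section Order

theorem analyticOrderAt_polynomial_eval {𝕜 : Type*} [NontriviallyNormedField 𝕜] {P : Polynomial 𝕜}
    (hP : P ≠ 0) (a : 𝕜) : analyticOrderAt P.eval a = P.rootMultiplicity a := by
  obtain ⟨Q, hPQ, hQ⟩ := Polynomial.exists_eq_pow_rootMultiplicity_mul_and_not_dvd P hP a
  refine (AnalyticAt.analyticOrderAt_eq_natCast (AnalyticOnNhd.eval_polynomial P a trivial)).2
    ⟨Q.eval, AnalyticOnNhd.eval_polynomial Q a trivial,
      fun h => hQ (Polynomial.dvd_iff_isRoot.2 h), .of_forall fun x => ?_⟩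
  conv_lhs => rw [hPQ]
  simp

namespace IsCircleFactorization

variable {𝕜 : Type*} [NontriviallyNormedField 𝕜] [IsUltrametricDist 𝕜] [CompleteSpace 𝕜]
  {ρ : ℝ} {f u : PowerSeries 𝕜} {Z : Multiset 𝕜} {s : ℕ}

theorem analyticOrderAt_eq_count [DecidableEq 𝕜] (h : IsCircleFactorization ρ f Z u s)
    (hρ : 0 < ρ) {z : 𝕜} (hz : ‖z‖ = ρ) : analyticOrderAt (seriesEval f) z = Z.count z := by
  have heq : seriesEval f =ᶠ[𝓝 z] (ofRoots Z).eval * seriesEval u := by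
    filter_upwards [Metric.ball_mem_nhds z hρ] with x hx
    rw [mem_ball_iff_norm, ← hz] at hx
    exact h.seriesEval_eq ((norm_eq_of_norm_sub_lt hx).trans hz)
  have hu := analyticAt_seriesEval hρ h.isRestricted hz
  have hu₀ : seriesEval u z ≠ 0 := by
    rw [← norm_pos_iff, h.isDominantRange.norm_seriesEval h.isRestricted hz]
    exact h.isDominantRange.weight_pos
  rw [analyticOrderAt_congr heq, analyticOrderAt_mul (AnalyticOnNhd.eval_polynomial _ z trivial) hu,
    analyticOrderAt_polynomial_eval (monic_ofRoots Z).ne_zero, hu.analyticOrderAt_eq_zero.2 hu₀,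
    add_zero, ← Polynomial.count_roots, roots_ofRoots]

theorem finprod_X_sub_C_pow_eq_ofRoots (h : IsCircleFactorization ρ f Z u s) (hρ : 0 < ρ) :
    ∏ᶠ z ∈ {z | ‖z‖ = ρ ∧ seriesEval f z = 0},
      (Polynomial.X - Polynomial.C z) ^ analyticOrderNatAt (seriesEval f) z = ofRoots Z := by
  classical
  have hzeros : {z | ‖z‖ = ρ ∧ seriesEval f z = 0} = ↑Z.toFinset := by
    ext z
    rw [Finset.mem_coe, Multiset.mem_toFinset, Set.mem_ofPred_eq]
    exact ⟨fun hz => (h.seriesEval_eq_zero_iff hz.1).1 hz.2,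
      fun hz => ⟨h.norm_eq z hz, (h.seriesEval_eq_zero_iff (h.norm_eq z hz)).2 hz⟩⟩
  rw [hzeros, finprod_mem_coe_finset, ofRoots, Finset.prod_multiset_map_count]
  refine Finset.prod_congr rfl fun z hz => ?_
  rw [analyticOrderNatAt,
    h.analyticOrderAt_eq_count hρ (h.norm_eq z (Multiset.mem_toFinset.1 hz)), ENat.toNat_natCast]

end IsCircleFactorization

end Order

section CharacteristicSequence

theorem IsDominantRange.weight_lt_of_radius_lt {𝕜 : Type*} [NormedField 𝕜] {ρ ρ' : ℝ}
    {f : PowerSeries 𝕜} {s t i : ℕ} (h : IsDominantRange ρ f s t) (hρ : 0 < ρ) (hlt : ρ < ρ')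
    (hi : i < t) : weight ρ' f i < weight ρ' f t := by
  have hscale : ∀ j, weight ρ' f j = weight ρ f j * (ρ' / ρ) ^ j := fun j => by
    rw [weight, weight, div_pow, mul_assoc, mul_div_cancel₀ _ (pow_pos hρ j).ne']
  have hquot : 1 < ρ' / ρ := (one_lt_div hρ).2 hlt
  have hpos : 0 < weight ρ f t := h.weight_eq ▸ h.weight_pos
  rw [hscale, hscale]
  calc weight ρ f i * (ρ' / ρ) ^ i ≤ weight ρ f t * (ρ' / ρ) ^ i := by
        have := h.weight_eq ▸ h.weight_le i
        gcongr
    _ < weight ρ f t * (ρ' / ρ) ^ t := by gcongr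

variable {p : ℕ} [hp : Fact p.Prime] {F : PowerSeries ℂ_[p]} {i j k : ℕ} {α : ℝ}

theorem one_lt_natCast_prime : (1 : ℝ) < p := mod_cast hp.out.one_lt

theorem rpow_prime_pos (α : ℝ) : 0 < (p : ℝ) ^ α :=
  Real.rpow_pos_of_pos (one_pos.trans one_lt_natCast_prime) α

theorem rpow_prime_neg_le_one {α : ℝ} (hα : 0 ≤ α) : (p : ℝ) ^ (-α) ≤ 1 :=
  Real.rpow_le_one_of_one_le_of_nonpos one_lt_natCast_prime.le (neg_nonpos.2 hα)

theorem vp_of_ne_zero {x : ℂ_[p]} (hx : x ≠ 0) : vp x = ((-Real.logb p ‖x‖ : ℝ) : EReal) :=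
  if_neg hx

@[simp]
theorem vp_zero : vp (0 : ℂ_[p]) = ⊤ := if_pos rfl

theorem vp_eq_coe_iff {x : ℂ_[p]} : vp x = α ↔ ‖x‖ = (p : ℝ) ^ (-α) := by
  have hp₁ := one_lt_natCast_prime (p := p)
  rcases eq_or_ne x 0 with rfl | hx
  · simp [(rpow_prime_pos (p := p) (-α)).ne]
  · rw [vp_of_ne_zero hx, EReal.coe_eq_coe_iff, neg_eq_iff_eq_neg,
      Real.logb_eq_iff_rpow_eq (one_pos.trans hp₁) hp₁.ne' (norm_pos_iff.2 hx), eq_comm]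

theorem quot_eq_bot (hj : coeff j F ≠ 0) (hji : j < i) (hi : coeff i F = 0) : quot F j i = ⊥ := by
  have hpos : (0 : ℝ) < i - j := sub_pos.2 (mod_cast hji)
  rw [quot, hi, vp_zero, vp_of_ne_zero hj, EReal.sub_top,
    EReal.bot_div_of_pos_ne_top (mod_cast hpos) (EReal.coe_ne_top _)]

theorem quot_eq_coe (hj : coeff j F ≠ 0) (hi : coeff i F ≠ 0) :
    quot F j i =
      ((Real.logb p ‖coeff i F‖ - Real.logb p ‖coeff j F‖) / ((i : ℝ) - j) : ℝ) := by
  rw [quot, vp_of_ne_zero hj, vp_of_ne_zero hi, ← EReal.coe_sub, ← EReal.coe_div]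
  congr 2; ring

theorem weight_pos (hi : coeff i F ≠ 0) (α : ℝ) : 0 < weight ((p : ℝ) ^ (-α)) F i :=
  mul_pos (norm_pos_iff.2 hi) (pow_pos (rpow_prime_pos _) _)

theorem logb_weight (hi : coeff i F ≠ 0) (α : ℝ) :
    Real.logb p (weight ((p : ℝ) ^ (-α)) F i) = Real.logb p ‖coeff i F‖ - i * α := by
  have hp₁ := one_lt_natCast_prime (p := p)
  rw [weight, Real.logb_mul (norm_ne_zero_iff.2 hi) (pow_pos (rpow_prime_pos _) _).ne',
    Real.logb_pow, Real.logb_rpow (one_pos.trans hp₁) hp₁.ne']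
  ring

theorem cmp_weight (hj : coeff j F ≠ 0) (hji : j < i) (α : ℝ) :
    cmp (weight ((p : ℝ) ^ (-α)) F i) (weight ((p : ℝ) ^ (-α)) F j) = cmp (quot F j i) α := by
  by_cases hi : coeff i F = 0
  · have hwi : weight ((p : ℝ) ^ (-α)) F i = 0 := by simp [weight, hi]
    rw [quot_eq_bot hj hji hi, hwi, (cmp_eq_lt_iff _ _).2 (weight_pos hj α),
      (cmp_eq_lt_iff _ _).2 (EReal.bot_lt_coe α)]
  · set A := Real.logb p ‖coeff i F‖
    set B := Real.logb p ‖coeff j F‖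
    have hpos : (0 : ℝ) < i - j := sub_pos.2 (mod_cast hji)
    rw [← (Real.strictMonoOn_logb (one_lt_natCast_prime (p := p))).cmp_map_eq (weight_pos hi α)
      (weight_pos hj α), logb_weight hi, logb_weight hj, quot_eq_coe hj hi,
      EReal.coe_strictMono.cmp_map_eq]
    calc cmp (A - i * α) (B - j * α) = cmp (A - B) (α * (i - j)) := by
          rw [← cmp_add_right _ _ (i * α - B)]; congr 1 <;> ring
      _ = cmp ((A - B) / (i - j)) α := by
          rw [← cmp_mul_pos_right hpos _ α, div_mul_cancel₀ _ hpos.ne']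

theorem weight_lt_iff (hj : coeff j F ≠ 0) (hji : j < i) (α : ℝ) :
    weight ((p : ℝ) ^ (-α)) F i < weight ((p : ℝ) ^ (-α)) F j ↔ quot F j i < α :=
  lt_iff_lt_of_cmp_eq_cmp (cmp_weight hj hji α)

theorem weight_le_iff (hj : coeff j F ≠ 0) (hji : j < i) (α : ℝ) :
    weight ((p : ℝ) ^ (-α)) F i ≤ weight ((p : ℝ) ^ (-α)) F j ↔ quot F j i ≤ α :=
  le_iff_le_of_cmp_eq_cmp (cmp_weight hj hji α)

theorem IsNextIndex.coeff_ne_zero (h : IsNextIndex F j k) (hj : coeff j F ≠ 0) :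
    coeff k F ≠ 0 := fun hk => by
  obtain ⟨⟨hjk, hmax⟩, hub⟩ := h
  rw [quot_eq_bot hj hjk hk] at hmax
  exact absurd (hub ⟨by omega, fun i hi => (hmax i hi).trans bot_le⟩) (Nat.lt_irrefl k)

theorem IsNextIndex.quot_lt (h : IsNextIndex F j k) (hi : k < i) : quot F j i < quot F j k := by
  obtain ⟨⟨hjk, hmax⟩, hub⟩ := h
  exact (hmax i (hjk.trans hi)).lt_of_ne fun heq =>
    hi.not_ge (hub ⟨hjk.trans hi, fun i' hi' => heq ▸ hmax i' hi'⟩)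

theorem IsNextIndex.isDominantRange (h : IsNextIndex F j k) (hα : quot F j k = α)
    (hj : coeff j F ≠ 0)
    (hleft : ∀ i < j, weight ((p : ℝ) ^ (-α)) F i < weight ((p : ℝ) ^ (-α)) F j) :
    IsDominantRange ((p : ℝ) ^ (-α)) F j k where
  weight_pos := weight_pos hj α
  weight_eq := (eq_iff_eq_of_cmp_eq_cmp (cmp_weight hj h.1.1 α)).2 hα
  weight_le i := by
    rcases lt_trichotomy i j with hi | rfl | hi
    · exact (hleft i hi).le
    · rfl
    · exact (weight_le_iff hj hi α).2 (hα ▸ h.1.2 i hi)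
  weight_lt_of_lt := hleft
  weight_lt_of_gt i hi := (weight_lt_iff hj (h.1.1.trans hi) α).2 (hα ▸ h.quot_lt hi)

theorem IsCharSeq.exists_isDominantRange {k : ℕ → ℕ} {n : ℕ} (h : IsCharSeq F k (n + 1)) :
    ∃ α : ℝ, quot F (k n) (k (n + 1)) = α ∧
      IsDominantRange ((p : ℝ) ^ (-α)) F (k n) (k (n + 1)) := by
  induction n with
  | zero =>
    have hnext := h.2 0 one_pos
    have hα := quot_eq_coe h.1.1 (hnext.coeff_ne_zero h.1.1)
    refine ⟨_, hα, hnext.isDominantRange hα h.1.1 fun i hi => ?_⟩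
    have hi₀ : coeff i F = 0 := of_not_not fun hne => hi.not_ge (h.1.2 hne)
    rw [weight, hi₀, norm_zero, zero_mul]
    exact weight_pos h.1.1 _
  | succ n ih =>
    obtain ⟨α, -, hdom⟩ := ih ⟨h.1, fun i hi => h.2 i (by omega)⟩
    have hnext := h.2 (n + 1) (by omega)
    have hne : coeff (k (n + 1)) F ≠ 0 := fun h₀ =>
      (hdom.weight_eq ▸ hdom.weight_pos).ne' (by simp [weight, h₀])
    have hβ := quot_eq_coe hne (hnext.coeff_ne_zero hne)
    refine ⟨_, hβ, hnext.isDominantRange hβ hne fun i hi =>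
      hdom.weight_lt_of_radius_lt (rpow_prime_pos _) ?_ hi⟩
    have hlt := hdom.weight_lt_of_gt _ hnext.1.1
    rw [← hdom.weight_eq, weight_lt_iff hne hnext.1.1, hβ, EReal.coe_lt_coe_iff] at hlt
    exact Real.rpow_lt_rpow_of_exponent_lt one_lt_natCast_prime (neg_lt_neg hlt)

end CharacteristicSequence

section CirclePoly

variable {p : ℕ} [Fact p.Prime] {F : PowerSeries ℂ_[p]} {α : ℝ}

theorem circlePoly_eq_ofRoots {Z : Multiset ℂ_[p]} {u : PowerSeries ℂ_[p]} {s : ℕ}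
    (h : IsCircleFactorization ((p : ℝ) ^ (-α)) F Z u s) : circlePoly F α = ofRoots Z := by
  have hzeros : {z | z ∈ circleC p α ∧ psEval F z = 0} =
      {z | ‖z‖ = (p : ℝ) ^ (-α) ∧ seriesEval F z = 0} :=
    Set.ext fun z => and_congr_left fun _ => vp_eq_coe_iff
  rw [circlePoly, hzeros]
  exact h.finprod_X_sub_C_pow_eq_ofRoots (rpow_prime_pos _)

end CirclePoly

section PairDistProd

variable {𝕜 : Type*} [NormedField 𝕜] {Z W Z' W' T : Multiset 𝕜} {x y : 𝕜} {ρ c : ℝ}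

/-- The product of the distances between the elements of `Z` and those of `W`, which is the
absolute value of the resultant of `ofRoots Z` and `ofRoots W`. -/
def pairDistProd (Z W : Multiset 𝕜) : ℝ := (Z.map (distProd W)).prod

theorem pairDistProd_comm (Z W : Multiset 𝕜) : pairDistProd Z W = pairDistProd W Z := by
  unfold pairDistProd distProd
  rw [Multiset.prod_map_prod_map]
  simp only [norm_sub_rev]

theorem pairDistProd_add_left (Z Z' W : Multiset 𝕜) :
    pairDistProd (Z + Z') W = pairDistProd Z W * pairDistProd Z' W := by simp [pairDistProd]

theorem pairDistProd_nonneg (Z W : Multiset 𝕜) : 0 ≤ pairDistProd Z W :=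
  Multiset.prod_map_nonneg fun z _ => distProd_nonneg W z

theorem pairDistProd_eq_pow_card (h : ∀ z ∈ Z, distProd W z = c) :
    pairDistProd Z W = c ^ Z.card := by
  rw [pairDistProd, Multiset.map_congr rfl h, Multiset.map_const', Multiset.prod_replicate]

theorem pairDistProd_le_one (h : ∀ z ∈ Z, distProd W z ≤ 1) : pairDistProd Z W ≤ 1 := by
  simpa [pairDistProd] using Multiset.prod_map_le_prod_map₀ (distProd W) (fun _ => 1)
    (fun z _ => distProd_nonneg W z) h

theorem exists_mem_distProd_pow_card_le (hZ : Z ≠ 0) (W : Multiset 𝕜) :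
    ∃ z ∈ Z, distProd W z ^ Z.card ≤ pairDistProd Z W := by
  classical
  obtain ⟨z, hz, hmin⟩ : ∃ z ∈ Z, ∀ z' ∈ Z, distProd W z ≤ distProd W z' := by
    simpa using Z.toFinset.exists_min_image (distProd W)
      (by simpa [Finset.nonempty_iff_ne_empty] using hZ)
  refine ⟨z, hz, ?_⟩
  simpa [pairDistProd] using Multiset.prod_map_le_prod_map₀ (fun _ => distProd W z) (distProd W)
    (fun _ _ => distProd_nonneg W z) hmin

theorem norm_resultant_ofRoots (Z W : Multiset 𝕜) :
    ‖(ofRoots Z).resultant (ofRoots W)‖ = pairDistProd Z W := by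
  have hsplits : (ofRoots Z).Splits := Polynomial.Splits.multisetProd fun q hq => by
    obtain ⟨z, -, rfl⟩ := Multiset.mem_map.1 hq
    exact Polynomial.Splits.X_sub_C z
  rw [Polynomial.resultant_eq_prod_eval _ _ _ le_rfl hsplits, (monic_ofRoots Z).leadingCoeff,
    one_pow, one_mul, roots_ofRoots]
  refine (map_multiset_prod (normHom (α := 𝕜)) _).trans ?_
  rw [Multiset.map_map, pairDistProd]
  exact congrArg _ (Multiset.map_congr rfl fun z _ => norm_eval_ofRoots W z)

theorem eq_of_max_eq_max {α : Type*} [LinearOrder α] {a b d : α} (h : max a d = max b d)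
    (hd : d < b) : a = b := by
  rw [max_eq_left hd.le] at h
  exact (max_eq_iff.1 h).elim And.left fun h' => absurd h'.1 hd.ne

theorem pairDistProd_congr (hZ' : ∀ z ∈ Z', ‖z‖ = ρ) (hW : ∀ w ∈ W, ‖w‖ = ρ) {δ : ℝ} (hδ₀ : 0 ≤ δ)
    (hδ : ∀ x, ‖x‖ = ρ → δ < max (distProd Z x) (distProd W x))
    (hZZ' : ∀ x, ‖x‖ = ρ → max (distProd Z' x) δ = max (distProd Z x) δ)
    (hWW' : ∀ x, ‖x‖ = ρ → max (distProd W' x) δ = max (distProd W x) δ) :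
    pairDistProd Z' W' = pairDistProd Z W := by
  have hZ'_eq : ∀ z ∈ Z', distProd W' z = distProd W z := fun z hz => by
    have hle : distProd Z z ≤ δ := by
      rw [← max_eq_right_iff, ← hZZ' z (hZ' z hz), distProd_eq_zero_iff.2 hz, max_eq_right hδ₀]
    exact eq_of_max_eq_max (hWW' z (hZ' z hz))
      ((lt_max_iff.1 (hδ z (hZ' z hz))).resolve_left hle.not_gt)
  have hW_eq : ∀ w ∈ W, distProd Z' w = distProd Z w := fun w hw => by
    refine eq_of_max_eq_max (hZZ' w (hW w hw)) ((lt_max_iff.1 (hδ w (hW w hw))).resolve_right ?_)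
    rw [distProd_eq_zero_iff.2 hw]
    exact hδ₀.not_gt
  calc pairDistProd Z' W'
      = pairDistProd Z' W := congrArg Multiset.prod (Multiset.map_congr rfl hZ'_eq)
    _ = pairDistProd W Z' := pairDistProd_comm _ _
    _ = pairDistProd W Z := congrArg Multiset.prod (Multiset.map_congr rfl hW_eq)
    _ = pairDistProd Z W := pairDistProd_comm _ _

variable [IsUltrametricDist 𝕜]

theorem distProd_le_of_forall_norm_sub_le (h : ∀ w ∈ W, ‖x - y‖ ≤ ‖x - w‖) :
    distProd W y ≤ distProd W x := by
  refine Multiset.prod_map_le_prod_map₀ _ _ (fun _ _ => norm_nonneg _) fun w hw => ?_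
  calc ‖y - w‖ ≤ max ‖y - x‖ ‖x - w‖ := by simpa only [dist_eq_norm] using dist_triangle_max y x w
    _ = ‖x - w‖ := max_eq_right (norm_sub_rev x y ▸ h w hw)

theorem exists_mem_distProd_le (hZ : Z ≠ 0) (W : Multiset 𝕜) (x : 𝕜) :
    ∃ y ∈ Z + W, distProd Z y ≤ distProd Z x ∧ distProd W y ≤ distProd W x := by
  obtain ⟨y, hy, hnear⟩ := exists_mem_forall_norm_sub_le (Z := Z + W) (by simp [hZ]) x
  exact ⟨y, hy,
    distProd_le_of_forall_norm_sub_le fun w hw => hnear w (Multiset.mem_add.2 (.inl hw)),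
    distProd_le_of_forall_norm_sub_le fun w hw => hnear w (Multiset.mem_add.2 (.inr hw))⟩

theorem distProd_le_one (hρ : ρ ≤ 1) (hW : ∀ w ∈ W, ‖w‖ = ρ) (hx : ‖x‖ = ρ) :
    distProd W x ≤ 1 := by
  have hdist : ∀ w ∈ W, ‖x - w‖ ≤ 1 := fun w hw => by
    have := dist_triangle_max x 0 w
    rw [dist_zero_right, dist_zero_left, dist_eq_norm, hx, hW w hw, max_self] at this
    exact this.trans hρ
  simpa [distProd] using Multiset.prod_map_le_prod_map₀ (fun w => ‖x - w‖) (fun _ => 1)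
    (fun _ _ => norm_nonneg _) hdist

theorem pairDistProd_rpow_le_distProd (hρ : ρ ≤ 1) (hZ : ∀ z ∈ Z, ‖z‖ = ρ)
    (hW : ∀ w ∈ W, ‖w‖ = ρ) (hx : ‖x‖ = ρ) (hT : T ≤ Z)
    (hconst : ∀ z ∈ T, distProd W z = distProd W x) (hc : 1 ≤ T.card * c) :
    pairDistProd Z W ^ c ≤ distProd W x := by
  have hle : ∀ z, ‖z‖ = ρ → distProd W z ≤ 1 := fun z hz => distProd_le_one hρ hW hz
  have hpos : 0 ≤ c := (pos_of_mul_pos_right (one_pos.trans_le hc) (Nat.cast_nonneg _)).le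
  have hpow : pairDistProd Z W ≤ distProd W x ^ T.card := by
    obtain ⟨T', rfl⟩ := Multiset.le_iff_exists_add.1 hT
    rw [pairDistProd_add_left, ← pairDistProd_eq_pow_card hconst]
    exact mul_le_of_le_one_right (pairDistProd_nonneg T W)
      (pairDistProd_le_one fun z hz => hle z (hZ z (Multiset.mem_add.2 (.inr hz))))
  calc pairDistProd Z W ^ c ≤ (distProd W x ^ T.card) ^ c :=
        Real.rpow_le_rpow (pairDistProd_nonneg Z W) hpow hpos
    _ = distProd W x ^ (T.card * c) := (Real.rpow_natCast_mul (distProd_nonneg W x) _ c).symm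
    _ ≤ distProd W x ^ (1 : ℝ) :=
        Real.rpow_le_rpow_of_exponent_ge' (distProd_nonneg W x) (hle x hx) zero_le_one hc
    _ = distProd W x := Real.rpow_one _

theorem pairDistProd_rpow_le_max (hZW : ∀ z ∈ Z, pairDistProd Z W ^ c ≤ distProd W z)
    (hWZ : ∀ w ∈ W, pairDistProd W Z ^ c ≤ distProd Z w) (x : 𝕜) :
    pairDistProd Z W ^ c ≤ max (distProd Z x) (distProd W x) := by
  rcases eq_or_ne Z 0 with rfl | hZ
  · simp [pairDistProd]
  obtain ⟨y, hy, hyZ, hyW⟩ := exists_mem_distProd_le hZ W x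
  rcases Multiset.mem_add.1 hy with hy | hy
  · exact (hZW y hy).trans (hyW.trans (le_max_right _ _))
  · rw [pairDistProd_comm]
    exact (hWZ y hy).trans (hyZ.trans (le_max_left _ _))

theorem pairDistProd_le_max (hρ : ρ ≤ 1) (hZ : ∀ z ∈ Z, ‖z‖ = ρ) (hW : ∀ w ∈ W, ‖w‖ = ρ) (x : 𝕜) :
    pairDistProd Z W ≤ max (distProd Z x) (distProd W x) := by
  rw [← Real.rpow_one (pairDistProd Z W)]
  exact pairDistProd_rpow_le_max
    (fun z hz => pairDistProd_rpow_le_distProd hρ hZ hW (hZ z hz)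
      (Multiset.singleton_le.2 hz) (by simp) (by simp))
    (fun w hw => pairDistProd_rpow_le_distProd hρ hW hZ (hW w hw)
      (Multiset.singleton_le.2 hw) (by simp) (by simp)) x

end PairDistProd

section Conjugates

open Polynomial (aeval)

theorem isIntegral_aeval {R A : Type*} [CommRing R] [CommRing A] [Algebra R A] {z : A}
    (hz : IsIntegral R z) (Q : Polynomial R) : IsIntegral R (aeval z Q) :=
  adjoin_le_integralClosure hz (Polynomial.aeval_mem_adjoin_singleton R z)

theorem isConjRoot_aeval {K A : Type*} [Field K] [CommRing A] [IsDomain A] [Algebra K A] {z w : A}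
    (hz : IsIntegral K z) (h : IsConjRoot K z w) (Q : Polynomial K) :
    IsConjRoot K (aeval z Q) (aeval w Q) := by
  have hdvd : minpoly K z ∣ (minpoly K (aeval z Q)).comp Q :=
    minpoly.dvd K z (by rw [Polynomial.aeval_comp, minpoly.aeval])
  refine isConjRoot_of_aeval_eq_zero (isIntegral_aeval hz Q) ?_
  rw [← Polynomial.aeval_comp]
  exact zero_dvd_iff.1 (h.aeval_eq_zero ▸ map_dvd (aeval w) hdvd)

variable {p : ℕ} [Fact p.Prime] {z w : ℂ_[p]} {ρ c : ℝ}

theorem norm_eq_spectralValue (hz : IsIntegral ℚ_[p] z) :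
    ‖z‖ = spectralValue (minpoly ℚ_[p] z) := by
  have := IntermediateField.isAlgebraic_adjoin_simple hz
  rw [← IntermediateField.minpoly_gen ℚ_[p] z]
  exact NormedAlgebra.norm_eq_spectralNorm ℚ_[p] (IntermediateField.AdjoinSimple.gen ℚ_[p] z)

variable {K : IntermediateField ℚ_[p] ℂ_[p]}

open Classical in
/-- The roots of `P` on the circle of radius `ρ`, with multiplicity. -/
noncomputable def circleRoots (ρ : ℝ) (P : Polynomial K) : Multiset ℂ_[p] :=
  (P.aroots ℂ_[p]).filter (‖·‖ = ρ)

theorem mem_circleRoots {P : Polynomial K} (hP : P ≠ 0) :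
    z ∈ circleRoots ρ P ↔ aeval z P = 0 ∧ ‖z‖ = ρ := by
  rw [circleRoots, Multiset.mem_filter, Polynomial.mem_aroots', and_iff_right
    ((Polynomial.map_ne_zero_iff (algebraMap K ℂ_[p]).injective).2 hP)]

theorem exists_isCircleFactorization_circleRoots (hρ : 0 < ρ) {P : Polynomial K} (hP : P ≠ 0) :
    ∃ u s, IsCircleFactorization ρ (P.map (algebraMap K ℂ_[p]) : Polynomial ℂ_[p])
      (circleRoots ρ P) u s := by
  classical
  obtain ⟨u, s, h⟩ := exists_isCircleFactorization_polynomial hρ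
    ((Polynomial.map_ne_zero_iff (algebraMap K ℂ_[p]).injective).2 hP)
  exact ⟨u, s, by rwa [circleRoots, Polynomial.aroots]⟩

theorem exists_norm_aeval_eq (hρ : 0 < ρ) {P : Polynomial K} (hP : P ≠ 0) :
    ∃ D > 0, ∀ x : ℂ_[p], ‖x‖ = ρ → ‖aeval x P‖ = D * distProd (circleRoots ρ P) x := by
  obtain ⟨u, s, h⟩ := exists_isCircleFactorization_circleRoots hρ hP
  refine ⟨weight ρ u s, h.isDominantRange.weight_pos, fun x hx => ?_⟩
  rw [← h.norm_seriesEval hx, seriesEval_coe, Polynomial.eval_map_algebraMap]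

variable [Algebra.IsAlgebraic ℚ_[p] K]

theorem norm_eq_of_isConjRoot (hz : IsIntegral K z) (h : IsConjRoot K z w) : ‖z‖ = ‖w‖ := by
  have hz' : IsIntegral ℚ_[p] z := isIntegral_trans z hz
  have hconj : IsConjRoot ℚ_[p] z w := h.of_isScalarTower hz'
  rw [norm_eq_spectralValue hz', norm_eq_spectralValue (hconj.isIntegral hz'), hconj]

theorem distProd_circleRoots_eq_of_isConjRoot (hρ : 0 < ρ) {Q : Polynomial K} (hQ : Q ≠ 0)
    (hz : IsIntegral K z) (hzρ : ‖z‖ = ρ) (h : IsConjRoot K z w) :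
    distProd (circleRoots ρ Q) w = distProd (circleRoots ρ Q) z := by
  obtain ⟨D, hD, hnorm⟩ := exists_norm_aeval_eq hρ hQ
  have hQzw := norm_eq_of_isConjRoot (isIntegral_aeval hz Q) (isConjRoot_aeval hz h Q)
  rw [hnorm z hzρ, hnorm w ((norm_eq_of_isConjRoot hz h).symm.trans hzρ)] at hQzw
  exact (mul_left_cancel₀ hD.ne' hQzw).symm

theorem aroots_minpoly_le_circleRoots {P : Polynomial K} (hP : P ≠ 0) (hz : z ∈ circleRoots ρ P) :
    (minpoly K z).aroots ℂ_[p] ≤ circleRoots ρ P := by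
  obtain ⟨hzP, hzρ⟩ := (mem_circleRoots hP).1 hz
  have hint : IsIntegral K z := IsAlgebraic.isIntegral ⟨P, hP, hzP⟩
  refine Multiset.le_filter.2 ⟨Polynomial.roots.le_of_dvd ?_ ?_, fun w hw => ?_⟩
  · exact (Polynomial.map_ne_zero_iff (algebraMap K ℂ_[p]).injective).2 hP
  · exact Polynomial.map_dvd _ (minpoly.dvd K z hzP)
  · exact (norm_eq_of_isConjRoot hint
      ((isConjRoot_iff_mem_minpoly_aroots hint).2 hw)).symm.trans hzρ

theorem pairDistProd_circleRoots_rpow_le (hρ : 0 < ρ) (hρ₁ : ρ ≤ 1) {P Q : Polynomial K}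
    (hP : P ≠ 0) (hQ : Q ≠ 0)
    (hc : ∀ z : ℂ_[p], ‖z‖ = ρ → IsIntegral K z → 1 ≤ (minpoly K z).natDegree * c)
    (hz : z ∈ circleRoots ρ P) :
    pairDistProd (circleRoots ρ P) (circleRoots ρ Q) ^ c ≤ distProd (circleRoots ρ Q) z := by
  obtain ⟨hzP, hzρ⟩ := (mem_circleRoots hP).1 hz
  have hint : IsIntegral K z := IsAlgebraic.isIntegral ⟨P, hP, hzP⟩
  have hcard : ((minpoly K z).aroots ℂ_[p]).card = (minpoly K z).natDegree := by
    rw [Polynomial.aroots, ← (IsAlgClosed.splits _).natDegree_eq_card_roots,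
      Polynomial.natDegree_map]
  exact pairDistProd_rpow_le_distProd hρ₁ (fun z hz => ((mem_circleRoots hP).1 hz).2)
    (fun w hw => ((mem_circleRoots hQ).1 hw).2) hzρ (aroots_minpoly_le_circleRoots hP hz)
    (fun w hw => distProd_circleRoots_eq_of_isConjRoot hρ hQ hint hzρ
      ((isConjRoot_iff_mem_minpoly_aroots hint).2 hw)) (hcard ▸ hc z hzρ hint)

end Conjugates

section RationalApproximation

variable {p : ℕ} [Fact p.Prime] {ρ c : ℝ} {f g u v : PowerSeries ℂ_[p]} {s t : ℕ}
  {K : IntermediateField ℚ_[p] ℂ_[p]} {Z W : Multiset ℂ_[p]}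

theorem exists_map_eq_trunc (hK : ∀ i, coeff i f ∈ K) (N : ℕ) :
    ∃ P : Polynomial K, P.map (algebraMap K ℂ_[p]) = trunc N f :=
  (Polynomial.mem_lifts _).1 <| (Polynomial.lifts_iff_coeff_lifts _).2 fun i => by
    rw [coeff_trunc]
    split_ifs
    · exact ⟨⟨_, hK i⟩, rfl⟩
    · exact ⟨0, map_zero _⟩

theorem IsCircleFactorization.exists_circleRoots_approx (h : IsCircleFactorization ρ f Z u s)
    (hρ : 0 < ρ) (hf : IsRestricted ρ f) (hK : ∀ i, coeff i f ∈ K) {δ : ℝ} (hδ : 0 < δ) :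
    ∃ P : Polynomial K, P ≠ 0 ∧ ∀ x : ℂ_[p], ‖x‖ = ρ →
      max (distProd (circleRoots ρ P) x) δ = max (distProd Z x) δ := by
  have hdom := h.isDominantRange_mul hρ
  set C := weight ρ u s
  have hC : 0 < C := h.isDominantRange.weight_pos
  obtain ⟨N, hN, hclose⟩ := exists_trunc_close hf (Z.card + s) (mul_pos hC hδ)
  obtain ⟨P, hP⟩ := exists_map_eq_trunc hK N
  have hdomP := hdom.trunc hρ.le hN
  rw [← hP] at hdomP hclose
  have hP₀ : P ≠ 0 := by
    rintro rfl
    exact hdomP.coeff_left_ne_zero (by simp)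
  obtain ⟨v, r, hv⟩ := exists_isCircleFactorization_circleRoots hρ hP₀
  have hvC : weight ρ v r = C := by
    rw [hv.weight_eq hρ hdomP, hP, Polynomial.coeff_coe, coeff_trunc, if_pos hN,
      ← h.weight_eq hρ hdom]
  refine ⟨P, hP₀, fun x hx => ?_⟩
  have hPx := hv.norm_seriesEval hx
  rw [seriesEval_coe, hvC] at hPx
  have hmax := max_norm_eq_of_norm_sub_le (hclose x hx)
  rw [h.norm_seriesEval hx, hPx, ← mul_max_of_nonneg _ _ hC.le,
    ← mul_max_of_nonneg _ _ hC.le] at hmax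
  exact (mul_left_cancel₀ hC.ne' hmax).symm

variable [Algebra.IsAlgebraic ℚ_[p] K]

theorem pairDistProd_rpow_le_max_of_coeff_mem (hρ : 0 < ρ) (hρ₁ : ρ ≤ 1)
    (hf : IsRestricted ρ f) (hg : IsRestricted ρ g) (hfK : ∀ i, coeff i f ∈ K)
    (hgK : ∀ i, coeff i g ∈ K) (hfZ : IsCircleFactorization ρ f Z u s)
    (hgW : IsCircleFactorization ρ g W v t) (hc₀ : 0 < c)
    (hc : ∀ z : ℂ_[p], ‖z‖ = ρ → IsIntegral K z → 1 ≤ (minpoly K z).natDegree * c)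
    {x : ℂ_[p]} (hx : ‖x‖ = ρ) :
    pairDistProd Z W ^ c ≤ max (distProd Z x) (distProd W x) := by
  rcases (pairDistProd_nonneg Z W).eq_or_lt with hR | hR
  · rw [← hR, Real.zero_rpow hc₀.ne']
    exact (distProd_nonneg Z x).trans (le_max_left _ _)
  set δ := pairDistProd Z W / 2
  have hδ : 0 < δ := half_pos hR
  have hlt : ∀ x, ‖x‖ = ρ → δ < max (distProd Z x) (distProd W x) := fun x _ =>
    (half_lt_self hR).trans_le (pairDistProd_le_max hρ₁ hfZ.norm_eq hgW.norm_eq x)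
  obtain ⟨P, hP, hPZ⟩ := hfZ.exists_circleRoots_approx hρ hf hfK hδ
  obtain ⟨Q, hQ, hQW⟩ := hgW.exists_circleRoots_approx hρ hg hgK hδ
  have hPQ := pairDistProd_rpow_le_max
    (fun z hz => pairDistProd_circleRoots_rpow_le hρ hρ₁ hP hQ hc hz)
    (fun w hw => pairDistProd_circleRoots_rpow_le hρ hρ₁ hQ hP hc hw) x
  rw [pairDistProd_congr (fun z hz => ((mem_circleRoots hP).1 hz).2) hgW.norm_eq hδ.le hlt hPZ hQW]
    at hPQ
  refine hPQ.trans (eq_of_max_eq_max ?_ (hlt x hx)).le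
  rw [sup_sup_distrib_right, hPZ x hx, hQW x hx, ← sup_sup_distrib_right]

end RationalApproximation

section Uniformizer

variable {p : ℕ} [Fact p.Prime] {K : IntermediateField ℚ_[p] ℂ_[p]} {ϖ x z a b : ℂ_[p]}

theorem IsUnif.exists_norm_eq_zpow (hϖ : IsUnif K ϖ) (hx : x ∈ K) (hx₀ : x ≠ 0) :
    ∃ d : ℤ, ‖x‖ = ‖ϖ‖ ^ d := by
  obtain ⟨hϖK, hϖ₀, hϖ₁, hmax⟩ := hϖ
  have hpos : 0 < ‖ϖ‖ := norm_pos_iff.2 hϖ₀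
  obtain ⟨n, hn₁, hn₂⟩ := exists_mem_Ioc_zpow (norm_pos_iff.2 hx₀) ((one_lt_inv₀ hpos).2 hϖ₁)
  simp only [inv_zpow'] at hn₁ hn₂
  refine ⟨-(n + 1), hn₂.antisymm (not_lt.1 fun hlt => ?_)⟩
  have hxϖ : ‖x * ϖ ^ (n + 1)‖ < 1 := calc
    _ = ‖x‖ * ‖ϖ‖ ^ (n + 1) := by rw [norm_mul, norm_zpow]
    _ < ‖ϖ‖ ^ (-(n + 1)) * ‖ϖ‖ ^ (n + 1) := by gcongr
    _ = 1 := by rw [← zpow_add₀ hpos.ne', neg_add_cancel, zpow_zero]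
  have hϖx : ‖ϖ‖ < ‖x * ϖ ^ (n + 1)‖ := calc
    ‖ϖ‖ = ‖ϖ‖ ^ (-n) * ‖ϖ‖ ^ (n + 1) := by
      rw [← zpow_add₀ hpos.ne', neg_add_cancel_left, zpow_one]
    _ < ‖x‖ * ‖ϖ‖ ^ (n + 1) := by gcongr
    _ = _ := by rw [norm_mul, norm_zpow]
  exact (hmax _ (K.mul_mem hx (zpow_mem hϖK _)) hxϖ).not_gt hϖx

theorem IsUnif.norm_eq_zpow (hϖ : IsUnif K ϖ) (hx : x ∈ K) (hx₀ : x ≠ 0) :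
    ‖x‖ = ‖ϖ‖ ^ vPi ϖ x := by
  have hex := hϖ.exists_norm_eq_zpow hx hx₀
  rw [vPi, dif_pos hex]
  exact hex.choose_spec

variable [Algebra.IsAlgebraic ℚ_[p] K]

theorem norm_coeff_zero_minpoly (hz : IsIntegral K z) :
    ‖((minpoly K z).coeff 0 : ℂ_[p])‖ = ‖z‖ ^ (minpoly K z).natDegree := by
  have hsplits : ((minpoly K z).map (algebraMap K ℂ_[p])).Splits := IsAlgClosed.splits _
  have hroots : ∀ w ∈ (minpoly K z).aroots ℂ_[p], ‖w‖ = ‖z‖ := fun w hw =>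
    (norm_eq_of_isConjRoot hz ((isConjRoot_iff_mem_minpoly_aroots hz).2 hw)).symm
  have hprod := hsplits.coeff_zero_eq_prod_roots_of_monic ((minpoly.monic hz).map _)
  rw [Polynomial.coeff_map] at hprod
  calc ‖((minpoly K z).coeff 0 : ℂ_[p])‖
      = ‖((minpoly K z).aroots ℂ_[p]).prod‖ := by
        refine (congrArg norm hprod).trans ?_
        rw [norm_mul, norm_pow, norm_neg, norm_one, one_pow, one_mul, Polynomial.aroots]
    _ = (((minpoly K z).aroots ℂ_[p]).map norm).prod :=
        map_multiset_prod (normHom (α := ℂ_[p])) _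
    _ = ‖z‖ ^ ((minpoly K z).aroots ℂ_[p]).card := by
        rw [Multiset.map_congr rfl hroots, Multiset.map_const', Multiset.prod_replicate]
    _ = ‖z‖ ^ (minpoly K z).natDegree := by
        rw [Polynomial.aroots, ← hsplits.natDegree_eq_card_roots, Polynomial.natDegree_map]

theorem IsUnif.dvd_natDegree_mul_vPi_sub (hϖ : IsUnif K ϖ) (hz : IsIntegral K z) (hz₀ : z ≠ 0)
    (ha : a ∈ K) (hb : b ∈ K) (ha₀ : a ≠ 0) (hb₀ : b ≠ 0) {d : ℕ} (hd : ‖a‖ * ‖z‖ ^ d = ‖b‖) :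
    (d : ℤ) ∣ (minpoly K z).natDegree * (vPi ϖ a - vPi ϖ b) := by
  have hnorm := norm_coeff_zero_minpoly hz
  set N := (minpoly K z).natDegree
  set c : K := (minpoly K z).coeff 0
  have hpos : 0 < ‖ϖ‖ := norm_pos_iff.2 hϖ.2.1
  have hc₀ : (c : ℂ_[p]) ≠ 0 := norm_ne_zero_iff.1 (hnorm ▸ pow_ne_zero _ (norm_ne_zero_iff.2 hz₀))
  rw [hϖ.norm_eq_zpow c.2 hc₀] at hnorm
  rw [hϖ.norm_eq_zpow ha ha₀, hϖ.norm_eq_zpow hb hb₀] at hd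
  have hzpow : ‖ϖ‖ ^ (vPi ϖ a * N + vPi ϖ (c : ℂ_[p]) * d) = ‖ϖ‖ ^ (vPi ϖ b * N) := by
    rw [zpow_add₀ hpos.ne', zpow_mul, zpow_mul, zpow_mul, hnorm, ← hd]
    simp only [zpow_natCast]
    ring
  have hexp := zpow_right_injective₀ hpos hϖ.2.2.1.ne hzpow
  exact ⟨-vPi ϖ (c : ℂ_[p]), by linear_combination hexp⟩

theorem IsUnif.dvd_natDegree_mul_gcd (hϖ : IsUnif K ϖ) (hz : IsIntegral K z) (hz₀ : z ≠ 0)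
    (ha : a ∈ K) (hb : b ∈ K) (ha₀ : a ≠ 0) (hb₀ : b ≠ 0) {d : ℕ} (hd : ‖a‖ * ‖z‖ ^ d = ‖b‖) :
    d ∣ (minpoly K z).natDegree * Int.gcd (vPi ϖ a - vPi ϖ b) d := by
  have hdvd := Int.dvd_coe_gcd (hϖ.dvd_natDegree_mul_vPi_sub hz hz₀ ha hb ha₀ hb₀ hd)
    (dvd_mul_left (d : ℤ) (minpoly K z).natDegree)
  rw [Int.gcd_mul_left, Int.natAbs_natCast] at hdvd
  exact_mod_cast hdvd

variable {ρ : ℝ} {F : PowerSeries ℂ_[p]} {k : ℕ → ℕ} {n : ℕ}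

theorem gcdRatio_eq_div (hlt : k (n - 1) < k n) :
    gcdRatio ϖ F k n = (Int.gcd (vPi ϖ (coeff (k n) F) - vPi ϖ (coeff (k (n - 1)) F))
      (k n - k (n - 1) : ℕ) : ℝ) / (k n - k (n - 1) : ℕ) := by
  rw [gcdRatio, Nat.cast_sub hlt.le, Nat.cast_sub hlt.le]

theorem gcdRatio_pos (hlt : k (n - 1) < k n) : 0 < gcdRatio ϖ F k n := by
  have hd : 0 < k n - k (n - 1) := Nat.sub_pos_of_lt hlt
  rw [gcdRatio_eq_div hlt]
  exact div_pos (mod_cast Int.gcd_pos_of_ne_zero_right _ (mod_cast hd.ne')) (mod_cast hd)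

theorem IsUnif.one_le_natDegree_mul_gcdRatio (hϖ : IsUnif K ϖ) (hρ : 0 < ρ)
    (hK : ∀ i, coeff i F ∈ K) (hlt : k (n - 1) < k n)
    (h : IsDominantRange ρ F (k (n - 1)) (k n)) (hz : ‖z‖ = ρ) (hint : IsIntegral K z) :
    1 ≤ (minpoly K z).natDegree * gcdRatio ϖ F k n := by
  have hd : 0 < k n - k (n - 1) := Nat.sub_pos_of_lt hlt
  have hnorm : ‖coeff (k n) F‖ * ‖z‖ ^ (k n - k (n - 1)) = ‖coeff (k (n - 1)) F‖ := by
    refine mul_right_cancel₀ (pow_pos hρ (k (n - 1))).ne' (Eq.trans ?_ h.weight_eq)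
    rw [hz, mul_assoc, pow_sub_mul_pow ρ hlt.le, weight]
  have hz₀ : z ≠ 0 := norm_pos_iff.1 (hz.symm ▸ hρ)
  have hdvd := hϖ.dvd_natDegree_mul_gcd hint hz₀ (hK _) (hK _) h.coeff_right_ne_zero
    h.coeff_left_ne_zero hnorm
  have hle := Nat.le_of_dvd (Nat.mul_pos (minpoly.natDegree_pos hint)
    (Int.gcd_pos_of_ne_zero_right _ (mod_cast hd.ne'))) hdvd
  rw [gcdRatio_eq_div hlt, ← mul_div_assoc, one_le_div (mod_cast hd)]
  exact_mod_cast hle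

theorem IsUnif.one_le_natDegree_mul_max_gcdRatio (hϖ : IsUnif K ϖ) (hρ : 0 < ρ)
    (hK : ∀ i, coeff i F ∈ K) (hlt : k (n - 1) < k n)
    (h : IsDominantRange ρ F (k (n - 1)) (k n)) (c : ℝ) (z : ℂ_[p]) (hz : ‖z‖ = ρ)
    (hint : IsIntegral K z) : 1 ≤ (minpoly K z).natDegree * max (gcdRatio ϖ F k n) c :=
  (hϖ.one_le_natDegree_mul_gcdRatio hρ hK hlt h hz hint).trans
    (mul_le_mul_of_nonneg_left (le_max_left _ _) (Nat.cast_nonneg _))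

end Uniformizer

section NormVal

variable {p : ℕ} {d e c : ℝ}

/-- The valuation `-log_p d` of the elements of absolute value `d`, with value `∞` at `d = 0`. -/
noncomputable def normVal (p : ℕ) (d : ℝ) : EReal :=
  if d = 0 then ⊤ else (-Real.logb p d : ℝ)

@[simp]
theorem normVal_zero : normVal p 0 = ⊤ := if_pos rfl

theorem normVal_of_pos (hd : 0 < d) : normVal p d = (-Real.logb p d : ℝ) := if_neg hd.ne'

theorem normVal_mul (hd : 0 < d) (he : 0 ≤ e) : normVal p (d * e) = normVal p d + normVal p e := by
  rcases he.eq_or_lt with rfl | he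
  · rw [mul_zero, normVal_zero, normVal_of_pos hd, EReal.coe_add_top]
  · rw [normVal_of_pos hd, normVal_of_pos he, normVal_of_pos (mul_pos hd he), ← EReal.coe_add,
      Real.logb_mul hd.ne' he.ne', neg_add]

theorem normVal_rpow (hc : 0 < c) (hd : 0 ≤ d) : normVal p (d ^ c) = c * normVal p d := by
  rcases hd.eq_or_lt with rfl | hd
  · rw [Real.zero_rpow hc.ne', normVal_zero, EReal.coe_mul_top_of_pos hc]
  · rw [normVal_of_pos hd, normVal_of_pos (Real.rpow_pos_of_pos hd c), ← EReal.coe_mul,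
      Real.logb_rpow_eq_mul_logb_of_pos hd, mul_neg]

theorem normVal_rpow_inv (hc : 0 < c) (hd : 0 ≤ d) : normVal p (d ^ c⁻¹) = normVal p d / c := by
  rw [normVal_rpow (inv_pos.2 hc) hd, EReal.div_eq_inv_mul, EReal.coe_inv]

variable [Fact p.Prime]

theorem vp_eq_normVal (x : ℂ_[p]) : vp x = normVal p ‖x‖ := by
  by_cases hx : x = 0 <;> simp [vp, normVal, hx]

theorem antitoneOn_normVal : AntitoneOn (normVal p) (Set.Ici 0) := by
  intro d (hd : 0 ≤ d) e _ hde
  rcases hd.eq_or_lt with rfl | hd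
  · simp
  · rw [normVal_of_pos hd, normVal_of_pos (hd.trans_le hde), EReal.coe_le_coe_iff, neg_le_neg_iff,
      Real.logb_le_logb one_lt_natCast_prime hd (hd.trans_le hde)]
    exact hde

theorem normVal_max (hd : 0 ≤ d) (he : 0 ≤ e) :
    normVal p (max d e) = min (normVal p d) (normVal p e) := antitoneOn_normVal.map_max hd he

theorem normVal_min (hd : 0 ≤ d) (he : 0 ≤ e) :
    normVal p (min d e) = max (normVal p d) (normVal p e) := antitoneOn_normVal.map_min hd he

end NormVal

section Phi

variable {p : ℕ} [Fact p.Prime] {ρ c : ℝ} {F G u v : PowerSeries ℂ_[p]} {Z W : Multiset ℂ_[p]}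
  {s t : ℕ} {x : ℂ_[p]}

theorem phi_eq_normVal (hF : IsCircleFactorization ρ F Z u s) (hG : IsCircleFactorization ρ G W v t)
    (hx : ‖x‖ = ρ) :
    phi F G x = normVal p (max (weight ρ u s * distProd Z x) (weight ρ v t * distProd W x)) := by
  rw [← hF.norm_seriesEval hx, ← hG.norm_seriesEval hx,
    normVal_max (norm_nonneg _) (norm_nonneg _), ← vp_eq_normVal, ← vp_eq_normVal]
  rfl

theorem exists_isGreatest_phi (hF : IsCircleFactorization ρ F Z u s)
    (hG : IsCircleFactorization ρ G W v t) (hZ : Z ≠ 0) :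
    ∃ x, ‖x‖ = ρ ∧ IsGreatest (phi F G '' {x | ‖x‖ = ρ}) (phi F G x) := by
  classical
  obtain ⟨y, hy, hmax⟩ := (Z + W).toFinset.exists_max_image (phi F G) (by simp [hZ])
  have hroot : ∀ z ∈ Z + W, ‖z‖ = ρ := fun z hz =>
    (Multiset.mem_add.1 hz).elim (hF.norm_eq z) (hG.norm_eq z)
  have hyρ := hroot y (Multiset.mem_toFinset.1 hy)
  refine ⟨y, hyρ, ⟨y, hyρ, rfl⟩, ?_⟩
  rintro _ ⟨x, hx, rfl⟩
  obtain ⟨z, hz, hzZ, hzW⟩ := exists_mem_distProd_le hZ W x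
  refine le_trans ?_ (hmax z (Multiset.mem_toFinset.2 hz))
  rw [phi_eq_normVal hF hG hx, phi_eq_normVal hF hG (hroot z hz)]
  have hC := hF.isDominantRange.weight_pos.le
  have hD := hG.isDominantRange.weight_pos.le
  exact antitoneOn_normVal (le_max_of_le_left (mul_nonneg hC (distProd_nonneg Z z)))
    (le_max_of_le_left (mul_nonneg hC (distProd_nonneg Z x)))
    (max_le_max (mul_le_mul_of_nonneg_left hzZ hC) (mul_le_mul_of_nonneg_left hzW hD))

theorem phi_eq_add_of_mem (hF : IsCircleFactorization ρ F Z u s)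
    (hG : IsCircleFactorization ρ G W v t) (hx : x ∈ Z) :
    phi F G x = normVal p (weight ρ v t) + normVal p (distProd W x) := by
  have hD := hG.isDominantRange.weight_pos
  rw [phi_eq_normVal hF hG (hF.norm_eq x hx), distProd_eq_zero_iff.2 hx, mul_zero,
    max_eq_right (mul_nonneg hD.le (distProd_nonneg W x)), normVal_mul hD (distProd_nonneg W x)]

theorem phi_comm (F G : PowerSeries ℂ_[p]) (x : ℂ_[p]) : phi F G x = phi G F x := min_comm _ _

theorem exists_le_phi (hF : IsCircleFactorization ρ F Z u s) (hG : IsCircleFactorization ρ G W v t)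
    (hZ : Z ≠ 0) :
    ∃ x, ‖x‖ = ρ ∧ normVal p (weight ρ v t) + normVal p (pairDistProd Z W) / (Z.card : ℝ) ≤
      phi F G x := by
  obtain ⟨z, hz, hle⟩ := exists_mem_distProd_pow_card_le hZ W
  have hcard : (0 : ℝ) < Z.card := mod_cast Multiset.card_pos.2 hZ
  have hR := pairDistProd_nonneg Z W
  have hroot : distProd W z ≤ pairDistProd Z W ^ (Z.card : ℝ)⁻¹ := by
    rwa [Real.le_rpow_inv_iff_of_pos (distProd_nonneg W z) hR hcard, Real.rpow_natCast]
  refine ⟨z, hF.norm_eq z hz, ?_⟩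
  rw [phi_eq_add_of_mem hF hG hz, ← normVal_rpow_inv hcard hR]
  gcongr
  exact antitoneOn_normVal (distProd_nonneg W z) (Real.rpow_nonneg hR _) hroot

theorem exists_min_le_phi (hF : IsCircleFactorization ρ F Z u s)
    (hG : IsCircleFactorization ρ G W v t) (hZ : Z ≠ 0) (hW : W ≠ 0) :
    ∃ x, ‖x‖ = ρ ∧ min (normVal p (weight ρ u s)) (normVal p (weight ρ v t)) +
      normVal p (pairDistProd Z W) / (min (W.card : ℝ) Z.card : ℝ) ≤ phi F G x := by
  rcases min_choice (W.card : ℝ) Z.card with h | h <;> rw [h]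
  · obtain ⟨x, hx, hle⟩ := exists_le_phi hG hF hW
    rw [phi_comm, pairDistProd_comm] at hle
    exact ⟨x, hx, le_trans (by gcongr; exact min_le_left _ _) hle⟩
  · obtain ⟨x, hx, hle⟩ := exists_le_phi hF hG hZ
    exact ⟨x, hx, le_trans (by gcongr; exact min_le_right _ _) hle⟩

theorem phi_le (hF : IsCircleFactorization ρ F Z u s) (hG : IsCircleFactorization ρ G W v t)
    (hx : ‖x‖ = ρ) (hc : 0 < c)
    (hle : pairDistProd Z W ^ c ≤ max (distProd Z x) (distProd W x)) :
    phi F G x ≤ max (normVal p (weight ρ u s)) (normVal p (weight ρ v t)) +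
      c * normVal p (pairDistProd Z W) := by
  have hC := hF.isDominantRange.weight_pos
  have hD := hG.isDominantRange.weight_pos
  have hR := pairDistProd_nonneg Z W
  have hRc := Real.rpow_nonneg hR c
  have hmin := lt_min hC hD
  rw [phi_eq_normVal hF hG hx, ← normVal_rpow hc hR, ← normVal_min hC.le hD.le,
    ← normVal_mul hmin hRc]
  refine antitoneOn_normVal (mul_nonneg hmin.le hRc)
    (le_max_of_le_left (mul_nonneg hC.le (distProd_nonneg Z x))) ?_
  calc min (weight ρ u s) (weight ρ v t) * pairDistProd Z W ^ c
      ≤ min (weight ρ u s) (weight ρ v t) * max (distProd Z x) (distProd W x) := by gcongr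
    _ ≤ max (weight ρ u s * distProd Z x) (weight ρ v t * distProd W x) := by
      rw [mul_max_of_nonneg _ _ hmin.le]
      exact max_le_max (mul_le_mul_of_nonneg_right (min_le_left _ _) (distProd_nonneg Z x))
        (mul_le_mul_of_nonneg_right (min_le_right _ _) (distProd_nonneg W x))

theorem phi_le_of_radius_le_one (hF : IsCircleFactorization ρ F Z u s)
    (hG : IsCircleFactorization ρ G W v t) (hρ : ρ ≤ 1) (hx : ‖x‖ = ρ) :
    phi F G x ≤ max (normVal p (weight ρ u s)) (normVal p (weight ρ v t)) +
      normVal p (pairDistProd Z W) := by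
  simpa using phi_le hF hG hx one_pos
    ((Real.rpow_one _).trans_le (pairDistProd_le_max hρ hF.norm_eq hG.norm_eq x))

end Phi

section CharacteristicCircle

theorem IsDominantRange.exists_norm_eq {𝕜 : Type*} [NormedField 𝕜] [IsAlgClosed 𝕜] {ρ : ℝ}
    {f : PowerSeries 𝕜} {s t : ℕ} (h : IsDominantRange ρ f s t) (hρ : 0 < ρ) (hst : s < t) :
    ∃ x : 𝕜, ‖x‖ = ρ := by
  have hd : t - s ≠ 0 := (Nat.sub_pos_of_lt hst).ne'
  obtain ⟨x, hx⟩ := IsAlgClosed.exists_pow_nat_eq (coeff s f / coeff t f)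
    (Nat.pos_of_ne_zero hd)
  refine ⟨x, (pow_left_inj₀ (norm_nonneg x) hρ.le hd).1 ?_⟩
  rw [← norm_pow, hx, norm_div, div_eq_iff (norm_ne_zero_iff.2 h.coeff_right_ne_zero)]
  refine mul_right_cancel₀ (pow_pos hρ s).ne' (h.weight_eq.symm.trans ?_)
  rw [weight, ← pow_sub_mul_pow ρ hst.le]
  ring

variable {p : ℕ} [Fact p.Prime] {F : PowerSeries ℂ_[p]} {k : ℕ → ℕ} {n : ℕ} {α : ℝ}

theorem circleC_coe (α : ℝ) : circleC p α = {x | ‖x‖ = (p : ℝ) ^ (-α)} :=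
  Set.ext fun _ => vp_eq_coe_iff

theorem IsCharSeq.exists_rootVal_eq (h : IsCharSeq F k n) (hn : 1 ≤ n) :
    ∃ α : ℝ, rootVal F k n = α ∧ k (n - 1) < k n ∧
      IsDominantRange ((p : ℝ) ^ (-α)) F (k (n - 1)) (k n) := by
  obtain ⟨n, rfl⟩ := Nat.exists_eq_add_of_le' hn
  obtain ⟨α, hα, hdom⟩ := h.exists_isDominantRange
  exact ⟨α, hα, (h.2 n n.lt_succ_self).1.1, hdom⟩

theorem IsDominantRange.isRestricted_of_convergesAt {s t : ℕ}
    (h : IsDominantRange ((p : ℝ) ^ (-α)) F s t) (hst : s < t)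
    (hF : ∀ x ∈ circleC p α, ConvergesAt F x) : IsRestricted ((p : ℝ) ^ (-α)) F := by
  obtain ⟨x, hx⟩ := h.exists_norm_eq (rpow_prime_pos _) hst
  exact isRestricted_of_summable hx (hF x (vp_eq_coe_iff.2 hx))

theorem IsDominantRange.exists_isCircleFactorization_of_convergesAt {s t : ℕ}
    (h : IsDominantRange ((p : ℝ) ^ (-α)) F s t) (hst : s < t)
    (hF : ∀ x ∈ circleC p α, ConvergesAt F x) :
    ∃ Z u, IsCircleFactorization ((p : ℝ) ^ (-α)) F Z u s ∧ Z ≠ 0 ∧ (t - s : ℝ) = Z.card := by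
  have hρ := rpow_prime_pos (p := p) (-α)
  obtain ⟨Z, u, hZ⟩ := h.exists_isCircleFactorization hρ (h.isRestricted_of_convergesAt hst hF)
  have hcard := hZ.card_eq_sub hρ h
  refine ⟨Z, u, hZ, Multiset.card_pos.1 (hcard ▸ Nat.sub_pos_of_lt hst), ?_⟩
  rw [hcard, Nat.cast_sub hst.le]

theorem shiftedVal_eq_normVal (hα : rootVal F k n = α) {Z : Multiset ℂ_[p]} {u : PowerSeries ℂ_[p]}
    {s : ℕ} (hdom : IsDominantRange ((p : ℝ) ^ (-α)) F (k (n - 1)) (k n))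
    (hF : IsCircleFactorization ((p : ℝ) ^ (-α)) F Z u s) :
    shiftedVal F k n = normVal p (weight ((p : ℝ) ^ (-α)) u s) := by
  have hρ := rpow_prime_pos (p := p) (-α)
  have hk := hdom.coeff_right_ne_zero
  rw [shiftedVal, hα, hF.weight_eq hρ hdom,
    normVal_mul (norm_pos_iff.2 hk) (pow_pos hρ _).le, vp_eq_normVal, normVal_of_pos (pow_pos hρ _),
    Real.logb_pow, Real.logb_rpow (zero_lt_one.trans one_lt_natCast_prime) one_lt_natCast_prime.ne',
    mul_neg, neg_neg, EReal.coe_mul]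

theorem vp_resultant_circlePoly {G : PowerSeries ℂ_[p]} {Z W : Multiset ℂ_[p]}
    {u v : PowerSeries ℂ_[p]} {s t : ℕ}
    (hF : IsCircleFactorization ((p : ℝ) ^ (-α)) F Z u s)
    (hG : IsCircleFactorization ((p : ℝ) ^ (-α)) G W v t) :
    vp ((circlePoly F α).resultant (circlePoly G α)) = normVal p (pairDistProd Z W) := by
  rw [circlePoly_eq_ofRoots hF, circlePoly_eq_ofRoots hG, vp_eq_normVal, norm_resultant_ofRoots]

end CharacteristicCircle

theorem theorem5p1_general (p : ℕ) [Fact p.Prime] (F G : PowerSeries ℂ_[p]) (k l : ℕ → ℕ) (n m : ℕ)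
    (hn : 1 ≤ n) (hm : 1 ≤ m) (hk : IsCharSeq F k n) (hl : IsCharSeq G l m)
    (hαβ : rootVal F k n = rootVal G l m)
    (hF : ∀ x ∈ circleC p (rootVal F k n), ConvergesAt F x)
    (hG : ∀ x ∈ circleC p (rootVal F k n), ConvergesAt G x)
    (a b : EReal) (ha : a = min (shiftedVal F k n) (shiftedVal G l m))
    (hb : b = max (shiftedVal F k n) (shiftedVal G l m))
    (r : ℂ_[p])
    (hr : r = Polynomial.resultant (circlePoly F (rootVal F k n))
      (circlePoly G (rootVal G l m))) :
    ∃ S : EReal, IsGreatest (phi F G '' circleC p (rootVal F k n)) S ∧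
      a + vp r / ((min ((l m : ℝ) - (l (m - 1) : ℝ)) ((k n : ℝ) - (k (n - 1) : ℝ)) : ℝ) : EReal)
        ≤ S ∧
      (0 ≤ rootVal F k n →
        S ≤ b + vp r ∧
        ∀ (K : IntermediateField ℚ_[p] ℂ_[p]) [Algebra.IsAlgebraic ℚ_[p] K] (ϖ : ℂ_[p]),
          IsUnif K ϖ →
          (∀ i : ℕ, PowerSeries.coeff i F ∈ K) → (∀ i : ℕ, PowerSeries.coeff i G ∈ K) →
          S ≤ b + ((max (gcdRatio ϖ F k n) (gcdRatio ϖ G l m) : ℝ) : EReal) * vp r) := by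
  obtain ⟨α, hα, hkn, hFdom⟩ := hk.exists_rootVal_eq hn
  obtain ⟨β, hβ, hlm, hGdom⟩ := hl.exists_rootVal_eq hm
  obtain rfl : α = β := by rwa [hα, hβ, EReal.coe_eq_coe_iff] at hαβ
  rw [hα] at hF hG hr ⊢
  rw [hβ] at hr
  obtain ⟨Z, u, hFZ, hZ, hZcard⟩ := hFdom.exists_isCircleFactorization_of_convergesAt hkn hF
  obtain ⟨W, v, hGW, hW, hWcard⟩ := hGdom.exists_isCircleFactorization_of_convergesAt hlm hG
  rw [ha, hb, hr, vp_resultant_circlePoly hFZ hGW, circleC_coe,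
    shiftedVal_eq_normVal hα hFdom hFZ, shiftedVal_eq_normVal hβ hGdom hGW, hZcard, hWcard]
  obtain ⟨x, hx, hmax⟩ := exists_isGreatest_phi hFZ hGW hZ
  obtain ⟨y, hy, hle⟩ := exists_min_le_phi hFZ hGW hZ hW
  refine ⟨_, hmax, hle.trans (hmax.2 ⟨y, hy, rfl⟩), fun hα₀ => ?_⟩
  have hρ := rpow_prime_pos (p := p) (-α)
  have hρ₁ := rpow_prime_neg_le_one (p := p) (EReal.coe_nonneg.1 hα₀)
  refine ⟨phi_le_of_radius_le_one hFZ hGW hρ₁ hx, fun K _ ϖ hϖ hFK hGK => ?_⟩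
  have hc₀ : 0 < max (gcdRatio ϖ F k n) (gcdRatio ϖ G l m) := lt_max_of_lt_left (gcdRatio_pos hkn)
  exact phi_le hFZ hGW hx hc₀ (pairDistProd_rpow_le_max_of_coeff_mem hρ hρ₁
    (hFdom.isRestricted_of_convergesAt hkn hF) (hGdom.isRestricted_of_convergesAt hlm hG) hFK hGK
    hFZ hGW hc₀ (hϖ.one_le_natDegree_mul_max_gcdRatio hρ hFK hkn hFdom _) hx)

theorem theorem5p1 (p : ℕ) [Fact p.Prime] (F G : PowerSeries ℂ_[p]) (k l : ℕ → ℕ) (n m : ℕ)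
    (hn : 1 ≤ n) (hm : 1 ≤ m) (hk : IsCharSeq F k n) (hl : IsCharSeq G l m)
    (hαβ : rootVal F k n = rootVal G l m)
    (hF : ∀ x ∈ circleC p (rootVal F k n), ConvergesAt F x)
    (hG : ∀ x ∈ circleC p (rootVal F k n), ConvergesAt G x)
    (a b : EReal) (ha : a = min (shiftedVal F k n) (shiftedVal G l m))
    (hb : b = max (shiftedVal F k n) (shiftedVal G l m))
    (r : ℂ_[p])
    (hr : r = Polynomial.resultant (circlePoly F (rootVal F k n))
      (circlePoly G (rootVal G l m))) :
    ∃ S : EReal, IsGreatest (phi F G '' circleC p (rootVal F k n)) S ∧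
      a + vp r / ((min ((l m : ℝ) - (l (m - 1) : ℝ)) ((k n : ℝ) - (k (n - 1) : ℝ)) : ℝ) : EReal)
        ≤ S ∧
      (0 ≤ rootVal F k n →
        S ≤ b + vp r ∧
        ∀ (K : IntermediateField ℚ_[p] ℂ_[p]) [FiniteDimensional ℚ_[p] K] (ϖ : ℂ_[p]),
          IsUnif K ϖ →
          (∀ i : ℕ, PowerSeries.coeff i F ∈ K) → (∀ i : ℕ, PowerSeries.coeff i G ∈ K) →
          S ≤ b + ((max (gcdRatio ϖ F k n) (gcdRatio ϖ G l m) : ℝ) : EReal) * vp r) := by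
  obtain ⟨S, hS, hlow, hup⟩ := theorem5p1_general p F G k l n m hn hm hk hl hαβ hF hG a b ha hb r hr
  exact ⟨S, hS, hlow, fun hα => ⟨(hup hα).1, fun K _ => (hup hα).2 K⟩⟩
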